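/- **Theorem (Completeness of the axiomatic linear-logic semantics of pure CHR).** *Constraints.* Fix function symbols, built-in constraint symbols (including falsity $\bot$ and binary equality $\doteq$), and user-defined constraint symbols, and countably infinitely many variables. Goals are built from $\top$, atomic user-defined constraints $c_u(\bar t)$ and atomic built-in constraints $c_b(\bar t)$ with $\wedge$; a user-defined (built-in) constraint $U$ ($B$) is a goal with only user-defined (built-in) atoms. $\equiv_G$ is the congruence on goals generated by associativity and commutativity of $\wedge$ and neutrality of $\top$. *Constraint theory.* $CT$ is a set of universally closed formulas $\forall(\exists\bar x.B\to\exists\bar x'.B')$; $CT\models\varphi$ means that the universal closure of $\varphi$ follows from $CT$ in first-order intuitionistic logic with equality $\doteq$. $CT$ is assumed complete, in the sense that for every built-in constraint $B$ either $CT\models\exists(B)$ or $CT\models\neg\exists(B)$, where $\exists(\cdot)$ is the existential closure. *States.* A state $\langle G;V\rangle$ is a goal $G$ with a finite set $V$ of (global) variables; $\langle U;B;V\rangle:=\langle U\wedge B;V\rangle$, and its strictly local variables are those of $B$ that are neither in $V$ nor in $U$. State equivalence $\equiv$ is the least equivalence relation with (1) $\langle G;V\rangle\equiv\langle G';V\rangle$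 if $G\equiv_G G'$; (2) $\langle U;x\doteq t\wedge B;V\rangle\equiv\langle U[x/t];x\doteq t\wedge B;V\rangle$, where $[x/t]$ replaces the variable $x$ by the term $t$; (3) $\langle U;B;V\rangle\equiv\langle U;B';V\rangle$ if $CT\models\exists\bar s.B\leftrightarrow\exists\bar s'.B'$, with $\bar s,\bar s'$ the respective strictly local variables; (4) $\langle G;\{x\}\cup V\rangle\equiv\langle G;V\rangle$ if $x$ does not occur in $G$; (5) $\langle G\wedge\bot;V\rangle\equiv\langle G'\wedge\bot;V'\rangle$ for all $G,G',V,V'$. *Programs.* A rule $H_1\setminus H_2\Leftrightarrow g\mid B_u\wedge B_b$ consists of user-defined constraints $H_1,H_2,B_u$, with $H_1,H_2$ not both empty, and built-in constraints $g,B_b$; its local variables $\bar y_r$ are those of $B_u,B_b,g$ that do not occur in $H_1,H_2$. A variant of a rule replaces its variables by pairwise distinct variables. A program $P$ is a set of rules. On equivalence classes of states, $[\langle H_1\wedge H_2\wedge U;\,g\wedge B;\,V\rangle]\mapsto[\langle H_1\wedge B_u\wedge U;\,g\wedge B_b\wedge B;\,V\rangle]$ whenever $H_1\setminus H_2\Leftrightarrow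 g\mid B_u\wedge B_b$ is a variant of a rule of $P$ whose local variables occur in none of $H_1,H_2,U,B,V$, and $CT\models\exists(g\wedge B)$. $\mapsto^*$ is the reflexive-transitive closure. *State entailment* $\triangleleft$ (written $S\triangleleft S'$: $S$ entails $S'$) is the least reflexive and transitive relation on equivalence classes of states with (a) $[\langle U;B;V\rangle]\triangleleft[\langle U;B';V\rangle]$ if $CT\models\exists\bar s.B\to\exists\bar s'.B'$, with $\bar s,\bar s'$ the respective strictly local variables; (b) $[\langle U;B;\{x\}\cup V\rangle]\triangleleft[\langle U;B;V\rangle]$. *Linear logic.* The reading $(\cdot)^L$ is $c_u(\bar t)^L=c_u(\bar t)$, $c_b(\bar t)^L={!}c_b(\bar t)$ for $c_b\neq\bot$, $\bot^L=\mathbf 0$, $\top^L=\mathbf 1$, $(G\wedge G')^L=G^L\otimes G'^L$, and $\langle G;V\rangle^L=\exists\bar l.\,G^L$, where $\bar l$ are the variables of $G$ not in $V$. Let $\vdash_\Sigma$ be provability in the sequent calculus of first-order intuitionistic linear logic (with cut) with the set $\Sigma=\Sigma_P\cup\Sigma_{CT}\cup\Sigma_{\doteq}$ of proper axioms, where - $\Sigma_P$: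 $H_1^L\otimes H_2^L\otimes g^L\vdash H_1^L\otimes\exists\bar y_r.(B_b^L\otimes B_u^L\otimes g^L)$ for each variant $H_1\setminus H_2\Leftrightarrow g\mid B_u\wedge B_b$ of a rule of $P$, with local variables $\bar y_r$; - $\Sigma_{CT}$: $\exists\bar x.B^L\vdash\exists\bar x'.B'^L$ whenever $CT\models\exists\bar x.B\to\exists\bar x'.B'$, for built-in constraints $B,B'$ and finite sets of variables $\bar x,\bar x'$; - $\Sigma_{\doteq}$: $c_u(\ldots,t_j,\ldots)\otimes{!}(t_j\doteq v)\vdash c_u(\ldots,v,\ldots)\otimes{!}(t_j\doteq v)$ for each user-defined $c_u$, each argument position $j$ and all terms. *Claim.* For all states $S,T$: if $S^L\vdash_\Sigma T^L$, then there is a state $T'$ such that $[S]\mapsto^*[T']$ and $[T']\triangleleft[T]$. -/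

import Mathlib

universe u

namespace CHR

/-! ### Constraints

`L` supplies the function symbols and the built-in constraint symbols other than equality and
falsity; `C` supplies the user-defined constraint symbols.  Variables are natural numbers. -/

/-- Conjunctions of atoms, as syntax; `top` is the empty conjunction. -/
inductive Conj (A : Type u) : Type u
  | top : Conj A
  | atom : A → Conj A
  | and : Conj A → Conj A → Conj A

namespace Conj

/-- Replace each atom. -/
def map {A B : Type u} (f : A → B) : Conj A → Conj B
  | top => top
  | atom a => atom (f a)
  | and G G' => and (G.map f) (G'.map f)

/-- The atom `a` occurs in the conjunction. -/
def Mem {A : Type u} (a : A) : Conj A → Prop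
  | top => False
  | atom b => a = b
  | and G G' => G.Mem a ∨ G'.Mem a

/-- Variables of a conjunction, given the variables of each atom. -/
def varsBy {A : Type u} (f : A → Finset ℕ) : Conj A → Finset ℕ
  | top => ∅
  | atom a => f a
  | and G G' => G.varsBy f ∪ G'.varsBy f

/-- Equivalence with respect to associativity, commutativity and neutrality of `top`. -/
inductive Equiv {A : Type u} : Conj A → Conj A → Prop
  | refl (G) : Equiv G G
  | symm {G G'} : Equiv G G' → Equiv G' G
  | trans {G G' G''} : Equiv G G' → Equiv G' G'' → Equiv G G''
  | congr {G₁ G₁' G₂ G₂'} : Equiv G₁ G₁' → Equiv G₂ G₂' → Equiv (and G₁ G₂) (and G₁' G₂')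
  | assoc (G G' G'') : Equiv (and (and G G') G'') (and G (and G' G''))
  | comm (G G') : Equiv (and G G') (and G' G)
  | top_and (G) : Equiv (and top G) G

theorem Mem.map {A B : Type u} (f : A → B) {a : A} :
    ∀ {G : Conj A}, G.Mem a → (G.map f).Mem (f a)
  | top, h => h.elim
  | atom _, h => congrArg f h
  | and _ _, h => h.imp (Mem.map f) (Mem.map f)

end Conj

/-- Atomic user-defined constraints. -/
inductive UserAtom (L : FirstOrder.Language.{u, u}) (C : ℕ → Type u) : Type u
  | mk {n : ℕ} (c : C n) (ts : Fin n → L.Term ℕ) : UserAtom L C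

/-- Atomic built-in constraints: falsity, syntactic equality, and the symbols of `L`. -/
inductive BuiltinAtom (L : FirstOrder.Language.{u, u}) : Type u
  | bot : BuiltinAtom L
  | eq (s t : L.Term ℕ) : BuiltinAtom L
  | rel {n : ℕ} (R : L.Relations n) (ts : Fin n → L.Term ℕ) : BuiltinAtom L

/-- The variables of an atomic user-defined constraint. -/
def UserAtom.vars {L : FirstOrder.Language.{u, u}} {C : ℕ → Type u} : UserAtom L C → Finset ℕ
  | mk _ ts => Finset.univ.biUnion fun i => (ts i).varFinset

/-- The variables of an atomic built-in constraint. -/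
def BuiltinAtom.vars {L : FirstOrder.Language.{u, u}} : BuiltinAtom L → Finset ℕ
  | bot => ∅
  | eq s t => s.varFinset ∪ t.varFinset
  | rel _ ts => Finset.univ.biUnion fun i => (ts i).varFinset

/-- Simultaneous substitution of terms for variables in an atomic user-defined constraint. -/
def UserAtom.subst {L : FirstOrder.Language.{u, u}} {C : ℕ → Type u} (σ : ℕ → L.Term ℕ) :
    UserAtom L C → UserAtom L C
  | mk c ts => mk c fun i => (ts i).subst σ

/-- Simultaneous substitution of terms for variables in an atomic built-in constraint. -/
def BuiltinAtom.subst {L : FirstOrder.Language.{u, u}} (σ : ℕ → L.Term ℕ) :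
    BuiltinAtom L → BuiltinAtom L
  | bot => bot
  | eq s t => eq (s.subst σ) (t.subst σ)
  | rel R ts => rel R fun i => (ts i).subst σ

/-- User-defined constraints. -/
abbrev UserC (L : FirstOrder.Language.{u, u}) (C : ℕ → Type u) : Type u := Conj (UserAtom L C)

/-- Built-in constraints. -/
abbrev BuiltinC (L : FirstOrder.Language.{u, u}) : Type u := Conj (BuiltinAtom L)

/-- Goals. -/
abbrev Goal (L : FirstOrder.Language.{u, u}) (C : ℕ → Type u) : Type u :=
  Conj (UserAtom L C ⊕ BuiltinAtom L)

/-- The variables of a user-defined constraint. -/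
def UserC.vars {L : FirstOrder.Language.{u, u}} {C : ℕ → Type u} (U : UserC L C) : Finset ℕ :=
  U.varsBy UserAtom.vars

/-- The variables of a built-in constraint. -/
def BuiltinC.vars {L : FirstOrder.Language.{u, u}} (B : BuiltinC L) : Finset ℕ :=
  B.varsBy BuiltinAtom.vars

/-- The variables of a goal. -/
def Goal.vars {L : FirstOrder.Language.{u, u}} {C : ℕ → Type u} (G : Goal L C) : Finset ℕ :=
  G.varsBy (Sum.elim UserAtom.vars BuiltinAtom.vars)

/-- A user-defined constraint as a goal. -/
def UserC.toGoal {L : FirstOrder.Language.{u, u}} {C : ℕ → Type u} (U : UserC L C) : Goal L C :=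
  U.map Sum.inl

/-- A built-in constraint as a goal. -/
def BuiltinC.toGoal {L : FirstOrder.Language.{u, u}} {C : ℕ → Type u} (B : BuiltinC L) :
    Goal L C :=
  B.map Sum.inr

/-- Substitution in a user-defined constraint. -/
def UserC.subst {L : FirstOrder.Language.{u, u}} {C : ℕ → Type u} (σ : ℕ → L.Term ℕ)
    (U : UserC L C) : UserC L C :=
  U.map (UserAtom.subst σ)

/-- Substitution in a built-in constraint. -/
def BuiltinC.subst {L : FirstOrder.Language.{u, u}} (σ : ℕ → L.Term ℕ) (B : BuiltinC L) :
    BuiltinC L :=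
  B.map (BuiltinAtom.subst σ)

/-- The substitution that replaces the variable `x` by the term `t`. -/
def single {L : FirstOrder.Language.{u, u}} (x : ℕ) (t : L.Term ℕ) : ℕ → L.Term ℕ :=
  Function.update FirstOrder.Language.Term.var x t

/-- The substitution that renames variables by `f`. -/
def renameVar {L : FirstOrder.Language.{u, u}} (f : ℕ → ℕ) : ℕ → L.Term ℕ :=
  fun x => FirstOrder.Language.Term.var (f x)

/-! ### Constraint theories -/

/-- Formulas of first-order intuitionistic logic with equality. -/
inductive IForm (L : FirstOrder.Language.{u, u}) : Type u
  | top : IForm L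
  | bot : IForm L
  | eq (s t : L.Term ℕ) : IForm L
  | rel {n : ℕ} (R : L.Relations n) (ts : Fin n → L.Term ℕ) : IForm L
  | and : IForm L → IForm L → IForm L
  | or : IForm L → IForm L → IForm L
  | imp : IForm L → IForm L → IForm L
  | ex (x : ℕ) : IForm L → IForm L
  | all (x : ℕ) : IForm L → IForm L

/-- Existential quantification over a finite set of variables. -/
def IForm.exs {L : FirstOrder.Language.{u, u}} (s : Finset ℕ) (φ : IForm L) : IForm L :=
  (s.sort (· ≤ ·)).foldr IForm.ex φ

/-- Bi-implication. -/
def IForm.iff {L : FirstOrder.Language.{u, u}} (φ ψ : IForm L) : IForm L :=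
  (φ.imp ψ).and (ψ.imp φ)

/-- Kripke models of first-order intuitionistic logic with equality: structures over a preorder
of worlds, connected by homomorphisms. -/
structure KripkeModel (L : FirstOrder.Language.{u, u}) where
  World : Type u
  [order : Preorder World]
  Dom : World → Type u
  [struc : ∀ w, L.Structure (Dom w)]
  [nonempty : ∀ w, Nonempty (Dom w)]
  map : ∀ {w w' : World}, w ≤ w' → L.Hom (Dom w) (Dom w')
  map_refl : ∀ (w : World) (d : Dom w), map (le_refl w) d = d
  map_trans : ∀ {w₁ w₂ w₃ : World} (h : w₁ ≤ w₂) (h' : w₂ ≤ w₃) (d : Dom w₁),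
    map (le_trans h h') d = map h' (map h d)

attribute [instance] KripkeModel.order KripkeModel.struc KripkeModel.nonempty

/-- Forcing at a world under a valuation of the variables. -/
def KripkeModel.Forces {L : FirstOrder.Language.{u, u}} (M : KripkeModel L) :
    IForm L → (w : M.World) → (ℕ → M.Dom w) → Prop
  | .top, _, _ => True
  | .bot, _, _ => False
  | .eq s t, _, v => s.realize v = t.realize v
  | .rel R ts, _, v => FirstOrder.Language.Structure.RelMap R fun i => (ts i).realize v
  | .and φ ψ, w, v => M.Forces φ w v ∧ M.Forces ψ w v
  | .or φ ψ, w, v => M.Forces φ w v ∨ M.Forces ψ w v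
  | .imp φ ψ, w, v => ∀ (w' : M.World) (h : w ≤ w'),
      M.Forces φ w' (fun x => M.map h (v x)) → M.Forces ψ w' (fun x => M.map h (v x))
  | .ex x φ, w, v => ∃ d : M.Dom w, M.Forces φ w (Function.update v x d)
  | .all x φ, w, v => ∀ (w' : M.World) (h : w ≤ w') (d : M.Dom w'),
      M.Forces φ w' (Function.update (fun y => M.map h (v y)) x d)

/-- A model validates the universal closure of a formula. -/
def KripkeModel.Valid {L : FirstOrder.Language.{u, u}} (M : KripkeModel L) (φ : IForm L) : Prop :=
  ∀ (w : M.World) (v : ℕ → M.Dom w), M.Forces φ w v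

/-- An atomic built-in constraint as a formula. -/
def BuiltinAtom.toIForm {L : FirstOrder.Language.{u, u}} : BuiltinAtom L → IForm L
  | bot => .bot
  | eq s t => .eq s t
  | rel R ts => .rel R ts

/-- A built-in constraint as a formula. -/
def BuiltinC.toIForm {L : FirstOrder.Language.{u, u}} : BuiltinC L → IForm L
  | .top => .top
  | .atom a => a.toIForm
  | .and B B' => .and (BuiltinC.toIForm B) (BuiltinC.toIForm B')

/-- The formula `∃ x̄. B → ∃ x̄'. B'`. -/
def geomImp {L : FirstOrder.Language.{u, u}} (x : Finset ℕ) (B : BuiltinC L) (x' : Finset ℕ)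
    (B' : BuiltinC L) : IForm L :=
  .imp (.exs x B.toIForm) (.exs x' B'.toIForm)

/-- A constraint theory, given by a set of (universally closed) formulas of the form
`∃ x̄. B → ∃ x̄'. B'`. -/
structure ConstraintTheory (L : FirstOrder.Language.{u, u}) where
  axs : Set (IForm L)
  form : ∀ φ ∈ axs, ∃ (x : Finset ℕ) (B : BuiltinC L) (x' : Finset ℕ) (B' : BuiltinC L),
    φ = geomImp x B x' B'

/-- The universal closure of `φ` is a consequence of `CT` in intuitionistic logic with equality. -/
def ConstraintTheory.Models {L : FirstOrder.Language.{u, u}} (CT : ConstraintTheory L)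
    (φ : IForm L) : Prop :=
  ∀ M : KripkeModel L, (∀ ψ ∈ CT.axs, M.Valid ψ) → M.Valid φ

/-- The existential closure of a built-in constraint. -/
def BuiltinC.exClosure {L : FirstOrder.Language.{u, u}} (B : BuiltinC L) : IForm L :=
  .exs B.vars B.toIForm

/-- Completeness of the constraint theory.  Only the sentences `∃(B)` with `B` a built-in
constraint are required to be decided, which is implied by completeness for all sentences. -/
def ConstraintTheory.IsComplete {L : FirstOrder.Language.{u, u}} (CT : ConstraintTheory L) : Prop :=
  ∀ B : BuiltinC L, CT.Models B.exClosure ∨ CT.Models (.imp B.exClosure .bot)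

/-! ### States and their equivalence -/

/-- CHR states: a goal and a finite set of global variables. -/
structure State (L : FirstOrder.Language.{u, u}) (C : ℕ → Type u) where
  store : Goal L C
  glob : Finset ℕ

/-- The state `⟨U ∧ B; V⟩`. -/
def State.normal {L : FirstOrder.Language.{u, u}} {C : ℕ → Type u} (U : UserC L C)
    (B : BuiltinC L) (V : Finset ℕ) : State L C :=
  ⟨.and U.toGoal B.toGoal, V⟩

/-- The strictly local variables of `⟨U ∧ B; V⟩`. -/
def strictLocals {L : FirstOrder.Language.{u, u}} {C : ℕ → Type u} (U : UserC L C)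
    (B : BuiltinC L) (V : Finset ℕ) : Finset ℕ :=
  ((U.vars ∪ B.vars) \ V) \ U.vars

/-- State equivalence. -/
inductive StateEquiv {L : FirstOrder.Language.{u, u}} {C : ℕ → Type u} (CT : ConstraintTheory L) :
    State L C → State L C → Prop
  | refl (S : State L C) : StateEquiv CT S S
  | symm {S T : State L C} : StateEquiv CT S T → StateEquiv CT T S
  | trans {S T R : State L C} : StateEquiv CT S T → StateEquiv CT T R → StateEquiv CT S R
  | goal {G G' : Goal L C} (V : Finset ℕ) : Conj.Equiv G G' → StateEquiv CT ⟨G, V⟩ ⟨G', V⟩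
  | subst (U : UserC L C) (x : ℕ) (t : L.Term ℕ) (B : BuiltinC L) (V : Finset ℕ) :
      StateEquiv CT
        (.normal U (.and (.atom (.eq (.var x) t)) B) V)
        (.normal (U.subst (single x t)) (.and (.atom (.eq (.var x) t)) B) V)
  | theory (U : UserC L C) (B B' : BuiltinC L) (V : Finset ℕ) :
      CT.Models (.iff (.exs (strictLocals U B V) B.toIForm)
        (.exs (strictLocals U B' V) B'.toIForm)) →
      StateEquiv CT (.normal U B V) (.normal U B' V)
  | redundant (G : Goal L C) (x : ℕ) (V : Finset ℕ) :
      x ∉ G.vars → StateEquiv CT ⟨G, insert x V⟩ ⟨G, V⟩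
  | failed (G G' : Goal L C) (V V' : Finset ℕ) :
      StateEquiv CT ⟨.and G (.atom (.inr .bot)), V⟩ ⟨.and G' (.atom (.inr .bot)), V'⟩

/-- State equivalence as a setoid. -/
def stateSetoid {L : FirstOrder.Language.{u, u}} (C : ℕ → Type u) (CT : ConstraintTheory L) :
    Setoid (State L C) where
  r := StateEquiv CT
  iseqv := ⟨.refl, .symm, .trans⟩

/-- Equivalence classes of states. -/
def StateClass {L : FirstOrder.Language.{u, u}} (C : ℕ → Type u) (CT : ConstraintTheory L) :
    Type u :=
  Quotient (stateSetoid C CT)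

/-- The equivalence class `[S]`. -/
def State.cls {L : FirstOrder.Language.{u, u}} {C : ℕ → Type u} (CT : ConstraintTheory L)
    (S : State L C) : StateClass C CT :=
  Quotient.mk (stateSetoid C CT) S

/-! ### Rules, programs, transitions, entailment -/

/-- A rule `H₁ \ H₂ ⇔ G | Bᵤ ∧ B_b` with non-empty head. -/
structure Rule (L : FirstOrder.Language.{u, u}) (C : ℕ → Type u) where
  kept : UserC L C
  removed : UserC L C
  guard : BuiltinC L
  bodyU : UserC L C
  bodyB : BuiltinC L
  head_nonempty : (∃ a, kept.Mem a) ∨ ∃ a, removed.Mem a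

/-- A program is a set of rules. -/
abbrev Program (L : FirstOrder.Language.{u, u}) (C : ℕ → Type u) : Type u := Set (Rule L C)

/-- The variables of the head. -/
def Rule.headVars {L : FirstOrder.Language.{u, u}} {C : ℕ → Type u} (r : Rule L C) : Finset ℕ :=
  r.kept.vars ∪ r.removed.vars

/-- The variables of guard and body. -/
def Rule.bodyVars {L : FirstOrder.Language.{u, u}} {C : ℕ → Type u} (r : Rule L C) : Finset ℕ :=
  r.bodyU.vars ∪ r.bodyB.vars ∪ r.guard.vars

/-- The local variables of a rule. -/
def Rule.locals {L : FirstOrder.Language.{u, u}} {C : ℕ → Type u} (r : Rule L C) : Finset ℕ :=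
  r.bodyVars \ r.headVars

/-- Renaming of the variables of a rule. -/
def Rule.rename {L : FirstOrder.Language.{u, u}} {C : ℕ → Type u} (f : ℕ → ℕ) (r : Rule L C) :
    Rule L C where
  kept := r.kept.subst (renameVar f)
  removed := r.removed.subst (renameVar f)
  guard := r.guard.subst (renameVar f)
  bodyU := r.bodyU.subst (renameVar f)
  bodyB := r.bodyB.subst (renameVar f)
  head_nonempty := r.head_nonempty.imp (fun ⟨_, h⟩ => ⟨_, h.map _⟩) (fun ⟨_, h⟩ => ⟨_, h.map _⟩)

/-- `r'` is a variant of `r`: the variables of `r` are replaced by pairwise distinct variables. -/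
def Rule.IsVariant {L : FirstOrder.Language.{u, u}} {C : ℕ → Type u} (r r' : Rule L C) : Prop :=
  ∃ f : ℕ → ℕ, Set.InjOn f (r.headVars ∪ r.bodyVars : Finset ℕ) ∧ r' = r.rename f

/-- The transition relation on equivalence classes of states. -/
inductive Step {L : FirstOrder.Language.{u, u}} {C : ℕ → Type u} (P : Program L C)
    (CT : ConstraintTheory L) : StateClass C CT → StateClass C CT → Prop
  | apply (r₀ r : Rule L C) (U : UserC L C) (B : BuiltinC L) (V : Finset ℕ) :
      r₀ ∈ P → r₀.IsVariant r →
      Disjoint r.locals (r.kept.vars ∪ r.removed.vars ∪ U.vars ∪ B.vars ∪ V) →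
      CT.Models (BuiltinC.exClosure (.and r.guard B)) →
      Step P CT
        (State.cls CT (.normal (.and r.kept (.and r.removed U)) (.and r.guard B) V))
        (State.cls CT
          (.normal (.and r.kept (.and r.bodyU U)) (.and r.guard (.and r.bodyB B)) V))

/-- State entailment, on equivalence classes of states. -/
inductive StateEntails {L : FirstOrder.Language.{u, u}} {C : ℕ → Type u}
    (CT : ConstraintTheory L) : StateClass C CT → StateClass C CT → Prop
  | refl (S : StateClass C CT) : StateEntails CT S S
  | trans {S T R : StateClass C CT} :
      StateEntails CT S T → StateEntails CT T R → StateEntails CT S R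
  | weaken (U : UserC L C) (B B' : BuiltinC L) (V : Finset ℕ) :
      CT.Models (geomImp (strictLocals U B V) B (strictLocals U B' V) B') →
      StateEntails CT (State.cls CT (.normal U B V)) (State.cls CT (.normal U B' V))
  | omit_global (U : UserC L C) (B : BuiltinC L) (x : ℕ) (V : Finset ℕ) :
      StateEntails CT (State.cls CT (.normal U B (insert x V))) (State.cls CT (.normal U B V))

/-! ### First-order intuitionistic linear logic -/

/-- Formulas with free variables in `ℕ` and bound variables `0, …, n - 1`; a quantifier binds the
last bound variable of its scope. -/
inductive LForm (L : FirstOrder.Language.{u, u}) (C : ℕ → Type u) : ℕ → Type u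
  | user {n k : ℕ} (c : C k) (ts : Fin k → L.Term (ℕ ⊕ Fin n)) : LForm L C n
  | eq {n : ℕ} (s t : L.Term (ℕ ⊕ Fin n)) : LForm L C n
  | rel {n k : ℕ} (R : L.Relations k) (ts : Fin k → L.Term (ℕ ⊕ Fin n)) : LForm L C n
  | one {n : ℕ} : LForm L C n
  | zero {n : ℕ} : LForm L C n
  | top {n : ℕ} : LForm L C n
  | tensor {n : ℕ} : LForm L C n → LForm L C n → LForm L C n
  | lolli {n : ℕ} : LForm L C n → LForm L C n → LForm L C n
  | amp {n : ℕ} : LForm L C n → LForm L C n → LForm L C n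
  | plus {n : ℕ} : LForm L C n → LForm L C n → LForm L C n
  | bang {n : ℕ} : LForm L C n → LForm L C n
  | ex {n : ℕ} : LForm L C (n + 1) → LForm L C n
  | all {n : ℕ} : LForm L C (n + 1) → LForm L C n

namespace LForm

variable {L : FirstOrder.Language.{u, u}} {C : ℕ → Type u}

/-- A substitution extended under a quantifier. -/
def lift {n m : ℕ} (σ : ℕ ⊕ Fin n → L.Term (ℕ ⊕ Fin m)) :
    ℕ ⊕ Fin (n + 1) → L.Term (ℕ ⊕ Fin (m + 1)) :=
  Sum.elim (fun x => (σ (.inl x)).relabel (Sum.map id Fin.castSucc))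
    (Fin.lastCases (.var (.inr (Fin.last m)))
      (fun i => (σ (.inr i)).relabel (Sum.map id Fin.castSucc)))

/-- Capture-avoiding substitution of terms for free and bound variables. -/
def subst : {n m : ℕ} → (ℕ ⊕ Fin n → L.Term (ℕ ⊕ Fin m)) → LForm L C n → LForm L C m
  | _, _, σ, user c ts => user c fun i => (ts i).subst σ
  | _, _, σ, eq s t => eq (s.subst σ) (t.subst σ)
  | _, _, σ, rel R ts => rel R fun i => (ts i).subst σ
  | _, _, _, one => one
  | _, _, _, zero => zero
  | _, _, _, top => top
  | _, _, σ, tensor α β => tensor (α.subst σ) (β.subst σ)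
  | _, _, σ, lolli α β => lolli (α.subst σ) (β.subst σ)
  | _, _, σ, amp α β => amp (α.subst σ) (β.subst σ)
  | _, _, σ, plus α β => plus (α.subst σ) (β.subst σ)
  | _, _, σ, bang α => bang (α.subst σ)
  | _, _, σ, ex α => ex (α.subst (lift σ))
  | _, _, σ, all α => all (α.subst (lift σ))

/-- The free variables. -/
def freeVars : {n : ℕ} → LForm L C n → Finset ℕ
  | _, user _ ts => Finset.univ.biUnion fun i => (ts i).varFinsetLeft
  | _, eq s t => s.varFinsetLeft ∪ t.varFinsetLeft
  | _, rel _ ts => Finset.univ.biUnion fun i => (ts i).varFinsetLeft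
  | _, one => ∅
  | _, zero => ∅
  | _, top => ∅
  | _, tensor α β => α.freeVars ∪ β.freeVars
  | _, lolli α β => α.freeVars ∪ β.freeVars
  | _, amp α β => α.freeVars ∪ β.freeVars
  | _, plus α β => α.freeVars ∪ β.freeVars
  | _, bang α => α.freeVars
  | _, ex α => α.freeVars
  | _, all α => α.freeVars

/-- Instantiation of the bound variable of a quantified formula by a term. -/
def inst (t : L.Term ℕ) (α : LForm L C 1) : LForm L C 0 :=
  α.subst (Sum.elim (fun x => .var (.inl x)) (fun _ => t.relabel Sum.inl))

/-- Existential quantification of the free variable `x`. -/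
def exVar (x : ℕ) (α : LForm L C 0) : LForm L C 0 :=
  ex (α.subst (Sum.elim (fun y => if y = x then .var (.inr 0) else .var (.inl y)) Fin.elim0))

/-- Existential quantification of a finite set of free variables. -/
def exs (s : Finset ℕ) (α : LForm L C 0) : LForm L C 0 :=
  (s.sort (· ≤ ·)).foldr exVar α

end LForm

/-- Sequents: a multiset of formulas and a formula. -/
abbrev Sequent (L : FirstOrder.Language.{u, u}) (C : ℕ → Type u) : Type u :=
  Multiset (LForm L C 0) × LForm L C 0

open LForm in
/-- Provability in the sequent calculus with the set `Ax` of proper axioms. -/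
inductive Provable {L : FirstOrder.Language.{u, u}} {C : ℕ → Type u} (Ax : Set (Sequent L C)) :
    Multiset (LForm L C 0) → LForm L C 0 → Prop
  | proper {Γ α} : (Γ, α) ∈ Ax → Provable Ax Γ α
  | identity (α) : Provable Ax {α} α
  | cut {Γ Δ α β} : Provable Ax Γ α → Provable Ax (α ::ₘ Δ) β → Provable Ax (Γ + Δ) β
  | tensorL {Γ α β γ} : Provable Ax (α ::ₘ β ::ₘ Γ) γ → Provable Ax (tensor α β ::ₘ Γ) γ
  | tensorR {Γ Δ α β} : Provable Ax Γ α → Provable Ax Δ β → Provable Ax (Γ + Δ) (tensor α β)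
  | oneL {Γ α} : Provable Ax Γ α → Provable Ax (one ::ₘ Γ) α
  | oneR : Provable Ax 0 one
  | lolliL {Γ Δ α β γ} : Provable Ax Γ α → Provable Ax (β ::ₘ Δ) γ →
      Provable Ax (lolli α β ::ₘ (Γ + Δ)) γ
  | lolliR {Γ α β} : Provable Ax (α ::ₘ Γ) β → Provable Ax Γ (lolli α β)
  | bangR {Γ : Multiset (LForm L C 0)} {α} : Provable Ax (Γ.map bang) α →
      Provable Ax (Γ.map bang) (bang α)
  | dereliction {Γ α β} : Provable Ax (α ::ₘ Γ) β → Provable Ax (bang α ::ₘ Γ) β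
  | contraction {Γ α β} : Provable Ax (bang α ::ₘ bang α ::ₘ Γ) β → Provable Ax (bang α ::ₘ Γ) β
  | weakening {Γ α β} : Provable Ax Γ β → Provable Ax (bang α ::ₘ Γ) β
  | ampL₁ {Γ α β γ} : Provable Ax (α ::ₘ Γ) γ → Provable Ax (amp α β ::ₘ Γ) γ
  | ampL₂ {Γ α β γ} : Provable Ax (β ::ₘ Γ) γ → Provable Ax (amp α β ::ₘ Γ) γ
  | ampR {Γ α β} : Provable Ax Γ α → Provable Ax Γ β → Provable Ax Γ (amp α β)
  | topR (Γ) : Provable Ax Γ top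
  | plusL {Γ α β γ} : Provable Ax (α ::ₘ Γ) γ → Provable Ax (β ::ₘ Γ) γ →
      Provable Ax (plus α β ::ₘ Γ) γ
  | plusR₁ {Γ α β} : Provable Ax Γ α → Provable Ax Γ (plus α β)
  | plusR₂ {Γ α β} : Provable Ax Γ β → Provable Ax Γ (plus α β)
  | zeroL (α) : Provable Ax {zero} α
  | allL {Γ α β} (t : L.Term ℕ) : Provable Ax (inst t α ::ₘ Γ) β → Provable Ax (all α ::ₘ Γ) β
  | allR {Γ β} (a : ℕ) : (∀ γ ∈ Γ, a ∉ γ.freeVars) → a ∉ β.freeVars →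
      Provable Ax Γ (inst (.var a) β) → Provable Ax Γ (all β)
  | exL {Γ α β} (a : ℕ) : (∀ γ ∈ Γ, a ∉ γ.freeVars) → a ∉ α.freeVars → a ∉ β.freeVars →
      Provable Ax (inst (.var a) α ::ₘ Γ) β → Provable Ax (ex α ::ₘ Γ) β
  | exR {Γ β} (t : L.Term ℕ) : Provable Ax Γ (inst t β) → Provable Ax Γ (ex β)

/-! ### Linear-logic reading and proper axioms -/

/-- A term with named variables as a term of the linear language. -/
def embed {L : FirstOrder.Language.{u, u}} (t : L.Term ℕ) : L.Term (ℕ ⊕ Fin 0) :=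
  t.relabel Sum.inl

/-- The reading of an atomic user-defined constraint. -/
def UserAtom.toL {L : FirstOrder.Language.{u, u}} {C : ℕ → Type u} : UserAtom L C → LForm L C 0
  | mk c ts => .user c fun i => embed (ts i)

/-- The reading of an atomic built-in constraint. -/
def BuiltinAtom.toL {L : FirstOrder.Language.{u, u}} (C : ℕ → Type u) :
    BuiltinAtom L → LForm L C 0
  | bot => .zero
  | eq s t => .bang (.eq (embed s) (embed t))
  | rel R ts => .bang (.rel R fun i => embed (ts i))

/-- The reading of a goal. -/
def Goal.toL {L : FirstOrder.Language.{u, u}} {C : ℕ → Type u} : Goal L C → LForm L C 0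
  | .top => .one
  | .atom (.inl a) => a.toL
  | .atom (.inr b) => b.toL C
  | .and G G' => .tensor (Goal.toL G) (Goal.toL G')

/-- The reading of a user-defined constraint. -/
def UserC.toL {L : FirstOrder.Language.{u, u}} {C : ℕ → Type u} (U : UserC L C) : LForm L C 0 :=
  Goal.toL U.toGoal

/-- The reading of a built-in constraint. -/
def BuiltinC.toL {L : FirstOrder.Language.{u, u}} (C : ℕ → Type u) (B : BuiltinC L) :
    LForm L C 0 :=
  Goal.toL B.toGoal

/-- The reading of a state: all variables that are not global are existentially quantified. -/
def State.toL {L : FirstOrder.Language.{u, u}} {C : ℕ → Type u} (S : State L C) : LForm L C 0 :=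
  .exs (S.store.vars \ S.glob) S.store.toL

/-- The proper axioms for the constraint theory. -/
def sigmaCT {L : FirstOrder.Language.{u, u}} (C : ℕ → Type u) (CT : ConstraintTheory L) :
    Set (Sequent L C) :=
  {s | ∃ (x : Finset ℕ) (B : BuiltinC L) (x' : Finset ℕ) (B' : BuiltinC L),
    CT.Models (geomImp x B x' B') ∧ s = ({.exs x (B.toL C)}, .exs x' (B'.toL C))}

/-- The proper axioms for equality and user-defined constraints. -/
def sigmaEq (L : FirstOrder.Language.{u, u}) (C : ℕ → Type u) : Set (Sequent L C) :=
  {s | ∃ (n : ℕ) (c : C n) (ts : Fin n → L.Term ℕ) (j : Fin n) (t : L.Term ℕ),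
    s = ({.tensor (UserAtom.mk c ts).toL ((BuiltinAtom.eq (ts j) t).toL C)},
      .tensor (UserAtom.mk c (Function.update ts j t)).toL ((BuiltinAtom.eq (ts j) t).toL C))}

/-- The proper axioms for the rules of a program. -/
def sigmaP {L : FirstOrder.Language.{u, u}} {C : ℕ → Type u} (P : Program L C) :
    Set (Sequent L C) :=
  {s | ∃ r₀ ∈ P, ∃ r : Rule L C, r₀.IsVariant r ∧
    s = ({.tensor r.kept.toL (.tensor r.removed.toL (r.guard.toL C))},
      .tensor r.kept.toL
        (.exs r.locals (.tensor (r.bodyB.toL C) (.tensor r.bodyU.toL (r.guard.toL C)))))}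

end CHR

/-!
Provability is compared with reachability through a phase model, so that neither cut elimination nor
an analysis of derivations is needed.

Fix the target `T` and a set `V` of global variables.  Goals, up to the equivalence of conjunctions,
are pairs of multisets of atoms (`Store`) and form a commutative monoid.  Its pole (`pole`) consists
of the goals `G` such that `⟨G; V⟩` reaches `T` by transitions and entailments in any order.  In the
phase space given by this pole, variables range over terms, an atom denotes the biorthogonal closure
of itself, and a goal denotes the closure of itself (`interp_goal`); the sequent calculus with cut
is sound (`Provable.sound`).  The proper axioms are valid: `sound_sigmaCT` and `sound_sigmaEq`
because the pole is closed under anti-entailment, `sound_sigmaP` because it is closed under inverse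
transitions.  If `S^L ⊢ T^L` then the goal of `S`, with fresh names for its local variables, is in
the denotation of `S^L`, hence in that of `T^L`, and the latter is contained in the pole since every
instance of the goal of `T` entails `T`.

The pole allows transitions and entailments to alternate.  To sort them, entailment is characterized
semantically.  `Refines` says that, for a fixed matching of the user-defined atoms of two states, at
each world of each model of the theory every solution of the first store yields one of the second
with the same values of matched atoms and of global variables.  Entailment implies refinement
(`StateEntails.refines`), by induction.  Conversely, if a consistent state refines another, then a
fresh copy of the other may be added to its store, together with the equations between matched
atoms, and these allow the atoms themselves to be exchanged (`Refines.exists_cfg_eq`); this gives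
entailment back (`Refines.stateEntails`).  The same rewriting exhibits in an entailing state the redex
of any transition of the entailed state (`StateEntails.exists_step`), and the sorting follows
(`exists_steps_entails`).  Completeness of the theory enters only to turn consistency of a store into
the solvability condition of transitions; inconsistent stores entail every state.
-/

namespace CHR

open FirstOrder Language

variable {L : FirstOrder.Language.{u, u}} {C : ℕ → Type u}

/-! ### Terms and atoms -/

theorem realize_congr {D : Type*} [L.Structure D] {v v' : ℕ → D} {t : L.Term ℕ}
    (h : ∀ x ∈ t.varFinset, v x = v' x) : t.realize v = t.realize v' := by
  induction t with
  | var x => exact h x (by simp [Term.varFinset])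
  | func f ts ih =>
    simp only [Term.realize]
    congr 1
    funext i
    exact ih i fun x hx => h x (by
      simp only [Term.varFinset, Finset.mem_biUnion, Finset.mem_univ, true_and]
      exact ⟨i, hx⟩)

theorem term_subst_congr {α β : Type*} [DecidableEq α] {σ τ : α → L.Term β} {t : L.Term α}
    (h : ∀ x ∈ t.varFinset, σ x = τ x) : t.subst σ = t.subst τ := by
  induction t with
  | var x => exact h x (by simp [Term.varFinset])
  | func f ts ih =>
    simp only [Term.subst]
    congr 1
    funext i
    exact ih i fun x hx => h x (by
      simp only [Term.varFinset, Finset.mem_biUnion, Finset.mem_univ, true_and]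
      exact ⟨i, hx⟩)

theorem term_subst_var {α : Type*} (t : L.Term α) : t.subst Term.var = t := by
  induction t with
  | var x => rfl
  | func f ts ih => simp [Term.subst, ih]

theorem term_subst_subst {α β γ : Type*} (σ : α → L.Term β) (τ : β → L.Term γ) (t : L.Term α) :
    (t.subst σ).subst τ = t.subst fun x => (σ x).subst τ := by
  induction t with
  | var x => rfl
  | func f ts ih => simp [Term.subst, ih]

theorem mem_varFinset_subst {σ : ℕ → L.Term ℕ} {t : L.Term ℕ} {y : ℕ} :
    y ∈ (t.subst σ).varFinset ↔ ∃ x ∈ t.varFinset, y ∈ (σ x).varFinset := by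
  induction t with
  | var x => simp [Term.subst, Term.varFinset]
  | func f ts ih =>
    simp only [Term.subst, Term.varFinset, Finset.mem_biUnion, Finset.mem_univ, true_and, ih]
    grind

namespace UserAtom

theorem mem_vars_mk {n : ℕ} {c : C n} {ts : Fin n → L.Term ℕ} {x : ℕ} :
    x ∈ (mk c ts : UserAtom L C).vars ↔ ∃ i, x ∈ (ts i).varFinset := by
  simp [vars]

theorem subst_congr {σ τ : ℕ → L.Term ℕ} {a : UserAtom L C} (h : ∀ x ∈ a.vars, σ x = τ x) :
    a.subst σ = a.subst τ := by
  obtain ⟨c, ts⟩ := a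
  simp only [subst]
  congr 1
  funext i
  exact term_subst_congr fun x hx => h x (mem_vars_mk.2 ⟨i, hx⟩)

theorem subst_var (a : UserAtom L C) : a.subst Term.var = a := by
  obtain ⟨c, ts⟩ := a
  simp [subst, term_subst_var]

theorem subst_subst (σ τ : ℕ → L.Term ℕ) (a : UserAtom L C) :
    (a.subst σ).subst τ = a.subst fun x => (σ x).subst τ := by
  obtain ⟨c, ts⟩ := a
  simp [subst, term_subst_subst]

theorem mem_vars_subst {σ : ℕ → L.Term ℕ} {a : UserAtom L C} {y : ℕ} :
    y ∈ (a.subst σ).vars ↔ ∃ x ∈ a.vars, y ∈ (σ x).varFinset := by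
  obtain ⟨c, ts⟩ := a
  simp only [subst, mem_vars_mk, mem_varFinset_subst]
  grind

/-- `Agree v v' a a'`: the atoms `a`, evaluated under `v`, and `a'`, evaluated under `v'`, are the
same atom over the domain. -/
inductive Agree {D : Type*} [L.Structure D] (v v' : ℕ → D) : UserAtom L C → UserAtom L C → Prop
  | mk {n : ℕ} (c : C n) (ts ts' : Fin n → L.Term ℕ)
      (h : ∀ i, (ts i).realize v = (ts' i).realize v') : Agree v v' (mk c ts) (mk c ts')

namespace Agree

variable {D : Type*} [L.Structure D] {v v' v'' : ℕ → D} {a a' a'' : UserAtom L C}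

theorem trans (h : Agree v v' a a') (h' : Agree v' v'' a' a'') : Agree v v'' a a'' := by
  obtain ⟨c, ts, ts', h⟩ := h
  cases h' with
  | mk _ _ ts'' h' => exact ⟨c, ts, ts'', fun i => (h i).trans (h' i)⟩

theorem symm (h : Agree v v' a a') : Agree v' v a' a := by
  obtain ⟨c, ts, ts', h⟩ := h
  exact ⟨c, ts', ts, fun i => (h i).symm⟩

theorem of_eqOn (h : ∀ x ∈ a.vars, v x = v' x) : Agree v v' a a := by
  obtain ⟨c, ts⟩ := a
  exact ⟨c, ts, ts, fun i => realize_congr fun x hx => h x (mem_vars_mk.2 ⟨i, hx⟩)⟩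

theorem of_subst (σ : ℕ → L.Term ℕ) (h : ∀ x ∈ a.vars, (σ x).realize v = v' x) :
    Agree v v' (a.subst σ) a := by
  obtain ⟨c, ts⟩ := a
  refine ⟨c, _, ts, fun i => ?_⟩
  rw [Term.realize_subst]
  exact realize_congr fun x hx => h x (mem_vars_mk.2 ⟨i, hx⟩)

theorem of_subst_subst (σ τ : ℕ → L.Term ℕ)
    (h : ∀ x ∈ a.vars, (σ x).realize v = (τ x).realize v') :
    Agree v v' (a.subst σ) (a.subst τ) :=
  (of_subst (v' := fun x => (τ x).realize v') σ h).trans (of_subst τ fun _ _ => rfl).symm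

end Agree

end UserAtom

namespace BuiltinAtom

theorem mem_vars_rel {n : ℕ} {R : L.Relations n} {ts : Fin n → L.Term ℕ} {x : ℕ} :
    x ∈ (rel R ts).vars ↔ ∃ i, x ∈ (ts i).varFinset := by
  simp [vars]

theorem subst_congr {σ τ : ℕ → L.Term ℕ} {a : BuiltinAtom L} (h : ∀ x ∈ a.vars, σ x = τ x) :
    a.subst σ = a.subst τ := by
  cases a with
  | bot => rfl
  | eq s t =>
    simp only [subst]
    rw [term_subst_congr fun x hx => h x (by simp [vars, hx]),
      term_subst_congr (t := t) fun x hx => h x (by simp [vars, hx])]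
  | rel R ts =>
    simp only [subst]
    congr 1
    funext i
    exact term_subst_congr fun x hx => h x (mem_vars_rel.2 ⟨i, hx⟩)

theorem subst_subst (σ τ : ℕ → L.Term ℕ) (a : BuiltinAtom L) :
    (a.subst σ).subst τ = a.subst fun x => (σ x).subst τ := by
  cases a <;> simp [subst, term_subst_subst]

theorem mem_vars_subst {σ : ℕ → L.Term ℕ} {a : BuiltinAtom L} {y : ℕ} :
    y ∈ (a.subst σ).vars ↔ ∃ x ∈ a.vars, y ∈ (σ x).varFinset := by
  cases a with
  | bot => simp [subst, vars]
  | eq s t =>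
    simp only [subst, vars, Finset.mem_union, mem_varFinset_subst]
    grind
  | rel R ts =>
    simp only [subst, mem_vars_rel, mem_varFinset_subst]
    grind

/-- Truth of an atomic built-in constraint in a structure. -/
def Holds {D : Type*} [L.Structure D] (v : ℕ → D) : BuiltinAtom L → Prop
  | bot => False
  | eq s t => s.realize v = t.realize v
  | rel R ts => Structure.RelMap R fun i => (ts i).realize v

theorem holds_congr {D : Type*} [L.Structure D] {v v' : ℕ → D} {a : BuiltinAtom L}
    (h : ∀ x ∈ a.vars, v x = v' x) : a.Holds v ↔ a.Holds v' := by
  cases a with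
  | bot => rfl
  | eq s t =>
    simp only [Holds]
    rw [realize_congr fun x hx => h x (by simp [vars, hx]),
      realize_congr (t := t) fun x hx => h x (by simp [vars, hx])]
  | rel R ts =>
    simp only [Holds]
    rw [show (fun i => (ts i).realize v) = fun i => (ts i).realize v' from
      funext fun i => realize_congr fun x hx => h x (mem_vars_rel.2 ⟨i, hx⟩)]

theorem holds_subst {D : Type*} [L.Structure D] {v : ℕ → D} {σ : ℕ → L.Term ℕ}
    {a : BuiltinAtom L} : (a.subst σ).Holds v ↔ a.Holds fun x => (σ x).realize v := by
  cases a <;> simp [subst, Holds, Term.realize_subst]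

end BuiltinAtom

/-! ### Stores as multisets of atoms -/

namespace Conj

/-- The multiset of atoms of a conjunction. -/
def atoms {A : Type u} : Conj A → Multiset A
  | top => 0
  | atom a => {a}
  | and G G' => G.atoms + G'.atoms

/-- The conjunction of a list of atoms. -/
def ofList {A : Type u} : List A → Conj A
  | [] => top
  | a :: l => and (atom a) (ofList l)

/-- A conjunction with a given multiset of atoms. -/
noncomputable def ofMultiset {A : Type u} (s : Multiset A) : Conj A := ofList s.toList

theorem atoms_ofList {A : Type u} (l : List A) : (ofList l).atoms = l := by
  induction l with
  | nil => rfl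
  | cons a l ih => simp [ofList, atoms, ih]

@[simp]
theorem atoms_ofMultiset {A : Type u} (s : Multiset A) : (ofMultiset s).atoms = s := by
  simp [ofMultiset, atoms_ofList]

theorem equiv_ofList_append {A : Type u} (l l' : List A) :
    Equiv (and (ofList l) (ofList l')) (ofList (l ++ l')) := by
  induction l with
  | nil => exact .top_and _
  | cons a l ih => exact (Equiv.assoc _ _ _).trans (.congr (.refl _) ih)

theorem equiv_ofList_of_perm {A : Type u} {l l' : List A} (h : l.Perm l') :
    Equiv (ofList l) (ofList l') := by
  induction h with
  | nil => exact .refl _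
  | cons a _ ih => exact .congr (.refl _) ih
  | swap a b l =>
    exact (Equiv.assoc _ _ _).symm.trans
      ((Equiv.congr (.comm _ _) (.refl _)).trans (.assoc _ _ _))
  | trans _ _ ih ih' => exact ih.trans ih'

/-- Every conjunction has a normal form as a list of atoms. -/
theorem exists_equiv_ofList {A : Type u} (G : Conj A) : ∃ l, Equiv G (ofList l) := by
  induction G with
  | top => exact ⟨[], .refl _⟩
  | atom a => exact ⟨[a], (Equiv.top_and _).symm.trans (.comm _ _)⟩
  | and G G' ih ih' =>
    obtain ⟨l, h⟩ := ih
    obtain ⟨l', h'⟩ := ih'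
    exact ⟨l ++ l', (Equiv.congr h h').trans (equiv_ofList_append l l')⟩

theorem Equiv.atoms_eq {A : Type u} {G G' : Conj A} (h : Equiv G G') : G.atoms = G'.atoms := by
  induction h with
  | refl => rfl
  | symm _ ih => exact ih.symm
  | trans _ _ ih ih' => exact ih.trans ih'
  | congr _ _ ih ih' => simp [atoms, ih, ih']
  | assoc => simp [atoms, add_assoc]
  | comm => simp [atoms, add_comm]
  | top_and => simp [atoms]

theorem equiv_iff_atoms_eq {A : Type u} {G G' : Conj A} : Equiv G G' ↔ G.atoms = G'.atoms := by
  refine ⟨Equiv.atoms_eq, fun h => ?_⟩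
  obtain ⟨l, hl⟩ := exists_equiv_ofList G
  obtain ⟨l', hl'⟩ := exists_equiv_ofList G'
  refine hl.trans ((equiv_ofList_of_perm ?_).trans hl'.symm)
  rw [← Multiset.coe_eq_coe, ← atoms_ofList, ← atoms_ofList, ← hl.atoms_eq, ← hl'.atoms_eq, h]

@[simp]
theorem atoms_map {A B : Type u} (f : A → B) (G : Conj A) : (G.map f).atoms = G.atoms.map f := by
  induction G with
  | top => rfl
  | atom a => rfl
  | and G G' ih ih' => simp [map, atoms, ih, ih']

theorem mem_varsBy {A : Type u} {f : A → Finset ℕ} {G : Conj A} {x : ℕ} :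
    x ∈ G.varsBy f ↔ ∃ a ∈ G.atoms, x ∈ f a := by
  induction G with
  | top => simp [varsBy, atoms]
  | atom a => simp [varsBy, atoms]
  | and G G' ih ih' => simp [varsBy, atoms, ih, ih', or_and_right, exists_or]

end Conj

/-- The variables of a multiset of atomic user-defined constraints. -/
def uvars (u : Multiset (UserAtom L C)) : Set ℕ := {x | ∃ a ∈ u, x ∈ a.vars}

/-- The variables of a multiset of atomic built-in constraints. -/
def bvars (b : Multiset (BuiltinAtom L)) : Set ℕ := {x | ∃ a ∈ b, x ∈ a.vars}

theorem UserC.mem_vars {U : UserC L C} {x : ℕ} : x ∈ U.vars ↔ x ∈ uvars U.atoms := Conj.mem_varsBy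

theorem BuiltinC.mem_vars {B : BuiltinC L} {x : ℕ} : x ∈ B.vars ↔ x ∈ bvars B.atoms :=
  Conj.mem_varsBy

theorem uvars_add (u u' : Multiset (UserAtom L C)) : uvars (u + u') = uvars u ∪ uvars u' := by
  ext x
  simp [uvars, or_and_right, exists_or]

theorem bvars_add (b b' : Multiset (BuiltinAtom L)) : bvars (b + b') = bvars b ∪ bvars b' := by
  ext x
  simp [bvars, or_and_right, exists_or]

theorem uvars_cons (a : UserAtom L C) (u : Multiset (UserAtom L C)) :
    uvars (a ::ₘ u) = ↑a.vars ∪ uvars u := by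
  ext x
  simp [uvars]

theorem bvars_cons (a : BuiltinAtom L) (b : Multiset (BuiltinAtom L)) :
    bvars (a ::ₘ b) = ↑a.vars ∪ bvars b := by
  ext x
  simp [bvars]

theorem uvars_finite (u : Multiset (UserAtom L C)) : (uvars u).Finite := by
  induction u using Multiset.induction_on with
  | empty => simp [uvars]
  | cons a u ih => rw [uvars_cons]; exact a.vars.finite_toSet.union ih

theorem bvars_finite (b : Multiset (BuiltinAtom L)) : (bvars b).Finite := by
  induction b using Multiset.induction_on with
  | empty => simp [bvars]
  | cons a b ih => rw [bvars_cons]; exact a.vars.finite_toSet.union ih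

theorem mem_uvars_map_subst {u : Multiset (UserAtom L C)} {σ : ℕ → L.Term ℕ} {y : ℕ} :
    y ∈ uvars (u.map (UserAtom.subst σ)) ↔ ∃ x ∈ uvars u, y ∈ (σ x).varFinset := by
  simp only [uvars, Multiset.mem_map, Set.mem_ofPred_eq, exists_exists_and_eq_and,
    UserAtom.mem_vars_subst]
  grind

theorem mem_bvars_map_subst {b : Multiset (BuiltinAtom L)} {σ : ℕ → L.Term ℕ} {y : ℕ} :
    y ∈ bvars (b.map (BuiltinAtom.subst σ)) ↔ ∃ x ∈ bvars b, y ∈ (σ x).varFinset := by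
  simp only [bvars, Multiset.mem_map, Set.mem_ofPred_eq, exists_exists_and_eq_and,
    BuiltinAtom.mem_vars_subst]
  grind

namespace Goal

/-- The user-defined part of a goal. -/
def users : Goal L C → Multiset (UserAtom L C)
  | .top => 0
  | .atom (.inl a) => {a}
  | .atom (.inr _) => 0
  | .and G G' => users G + users G'

/-- The built-in part of a goal. -/
def builtins : Goal L C → Multiset (BuiltinAtom L)
  | .top => 0
  | .atom (.inl _) => 0
  | .atom (.inr b) => {b}
  | .and G G' => builtins G + builtins G'

theorem atoms_eq (G : Goal L C) : G.atoms = (users G).map .inl + (builtins G).map .inr := by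
  induction G with
  | top => rfl
  | atom a => cases a <;> rfl
  | and G G' ih ih' =>
    simp only [Conj.atoms, users, builtins, ih, ih', Multiset.map_add]
    exact add_add_add_comm _ _ _ _

theorem users_eq_of_equiv {G G' : Goal L C} (h : Conj.Equiv G G') : users G = users G' := by
  induction h with
  | refl => rfl
  | symm _ ih => exact ih.symm
  | trans _ _ ih ih' => exact ih.trans ih'
  | congr _ _ ih ih' => exact congrArg₂ (· + ·) ih ih'
  | assoc => exact add_assoc _ _ _
  | comm => exact add_comm _ _
  | top_and => exact zero_add _

theorem builtins_eq_of_equiv {G G' : Goal L C} (h : Conj.Equiv G G') :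
    builtins G = builtins G' := by
  induction h with
  | refl => rfl
  | symm _ ih => exact ih.symm
  | trans _ _ ih ih' => exact ih.trans ih'
  | congr _ _ ih ih' => exact congrArg₂ (· + ·) ih ih'
  | assoc => exact add_assoc _ _ _
  | comm => exact add_comm _ _
  | top_and => exact zero_add _

@[simp]
theorem users_toGoal (U : UserC L C) : users U.toGoal = U.atoms := by
  induction U with
  | top => rfl
  | atom a => rfl
  | and U U' ih ih' => exact congrArg₂ _ ih ih'

@[simp]
theorem builtins_toGoal (U : UserC L C) : builtins U.toGoal = 0 := by
  induction U with
  | top => rfl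
  | atom a => rfl
  | and U U' ih ih' => exact (congrArg₂ (· + ·) ih ih').trans (add_zero 0)

@[simp]
theorem users_builtin_toGoal (B : BuiltinC L) : users (C := C) B.toGoal = 0 := by
  induction B with
  | top => rfl
  | atom a => rfl
  | and U U' ih ih' => exact (congrArg₂ (· + ·) ih ih').trans (add_zero 0)

@[simp]
theorem builtins_builtin_toGoal (B : BuiltinC L) : builtins (C := C) B.toGoal = B.atoms := by
  induction B with
  | top => rfl
  | atom a => rfl
  | and U U' ih ih' => exact congrArg₂ _ ih ih'

theorem mem_vars {G : Goal L C} {x : ℕ} :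
    x ∈ G.vars ↔ x ∈ uvars (users G) ∨ x ∈ bvars (builtins G) := by
  simp only [vars, Conj.mem_varsBy, atoms_eq, Multiset.mem_add, Multiset.mem_map, uvars, bvars,
    Set.mem_ofPred_eq]
  constructor
  · rintro ⟨_, ⟨a, ha, rfl⟩ | ⟨a, ha, rfl⟩, hx⟩
    exacts [.inl ⟨a, ha, hx⟩, .inr ⟨a, ha, hx⟩]
  · rintro (⟨a, ha, hx⟩ | ⟨a, ha, hx⟩)
    exacts [⟨_, .inl ⟨a, ha, rfl⟩, hx⟩, ⟨_, .inr ⟨a, ha, rfl⟩, hx⟩]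

end Goal

/-! ### Models of the constraint theory -/

/-- A world of a Kripke model of the constraint theory. -/
structure ModelPoint (CT : ConstraintTheory L) where
  model : KripkeModel L
  valid : ∀ ψ ∈ CT.axs, model.Valid ψ
  world : model.World

namespace ModelPoint

variable {CT : ConstraintTheory L}

/-- The domain at a world. -/
abbrev Dom (p : ModelPoint CT) : Type u := p.model.Dom p.world

/-- Forcing at a world of a model. -/
abbrev Forces (p : ModelPoint CT) (φ : IForm L) (v : ℕ → p.Dom) : Prop :=
  p.model.Forces φ p.world v

end ModelPoint

/-- A multiset of atomic built-in constraints holds under a valuation. -/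
def Sat {D : Type*} [L.Structure D] (v : ℕ → D) (b : Multiset (BuiltinAtom L)) : Prop :=
  ∀ a ∈ b, a.Holds v

section Sat

variable {D : Type*} [L.Structure D] {v v' : ℕ → D} {b b' : Multiset (BuiltinAtom L)}

@[simp]
theorem sat_add : Sat v (b + b') ↔ Sat v b ∧ Sat v b' := by
  simp [Sat, or_imp, forall_and]

@[simp]
theorem sat_cons {a : BuiltinAtom L} : Sat v (a ::ₘ b) ↔ a.Holds v ∧ Sat v b := by
  simp [Sat]

theorem sat_congr (h : ∀ x ∈ bvars b, v x = v' x) : Sat v b ↔ Sat v' b :=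
  forall₂_congr fun a ha => BuiltinAtom.holds_congr fun x hx => h x ⟨a, ha, hx⟩

theorem sat_subst {σ : ℕ → L.Term ℕ} :
    Sat v (b.map (BuiltinAtom.subst σ)) ↔ Sat (fun x => (σ x).realize v) b := by
  simp [Sat, BuiltinAtom.holds_subst]

end Sat

section Forces

variable {CT : ConstraintTheory L} (p : ModelPoint CT)

theorem forces_builtin {B : BuiltinC L} {v : ℕ → p.Dom} :
    p.Forces B.toIForm v ↔ Sat v B.atoms := by
  induction B with
  | top => simp [BuiltinC.toIForm, KripkeModel.Forces, Conj.atoms, Sat]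
  | atom a =>
    cases a <;> simp [BuiltinC.toIForm, KripkeModel.Forces, Conj.atoms, Sat, BuiltinAtom.toIForm,
      BuiltinAtom.Holds]
  | and B B' ih ih' =>
    simp [BuiltinC.toIForm, KripkeModel.Forces, Conj.atoms, ih, ih']

theorem forces_exs {s : Finset ℕ} {φ : IForm L} {v : ℕ → p.Dom} :
    p.Forces (.exs s φ) v ↔ ∃ v', (∀ x ∉ s, v' x = v x) ∧ p.Forces φ v' := by
  have key : ∀ (l : List ℕ) (v : ℕ → p.Dom),
      p.Forces (l.foldr IForm.ex φ) v ↔ ∃ v', (∀ x ∉ l, v' x = v x) ∧ p.Forces φ v' := by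
    intro l
    induction l with
    | nil =>
      intro v
      simp only [List.foldr_nil, List.not_mem_nil, not_false_eq_true, forall_true_left]
      exact ⟨fun h => ⟨v, fun _ => rfl, h⟩, fun ⟨v', h, h'⟩ => funext h ▸ h'⟩
    | cons y l ih =>
      intro v
      simp only [List.foldr_cons, KripkeModel.Forces, ih, List.mem_cons, not_or, and_imp]
      constructor
      · rintro ⟨d, v', h, h'⟩
        exact ⟨v', fun x hx hl => (h x hl).trans (Function.update_of_ne hx _ _), h'⟩
      · rintro ⟨v', h, h'⟩
        refine ⟨v' y, v', fun x hl => ?_, h'⟩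
        by_cases hx : x = y
        · subst hx; simp
        · rw [Function.update_of_ne hx]; exact h x hx hl
  have := key (s.sort (· ≤ ·)) v
  simp only [Finset.mem_sort] at this
  exact this

/-- The outer implication and the universal closure may be read pointwise, since every later world
and every valuation there is again covered by validity. -/
theorem models_imp {φ ψ : IForm L} :
    CT.Models (.imp φ ψ) ↔ ∀ (p : ModelPoint CT) v, p.Forces φ v → p.Forces ψ v := by
  constructor
  · intro h p v hφ
    have := h p.model p.valid p.world v p.world le_rfl
    simp only [p.model.map_refl] at this
    exact this hφ
  · intro h M hM w v w' hw hφ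
    exact h ⟨M, hM, w'⟩ _ hφ

theorem models_iff {φ ψ : IForm L} :
    CT.Models (φ.iff ψ) ↔ CT.Models (.imp φ ψ) ∧ CT.Models (.imp ψ φ) :=
  ⟨fun h => ⟨fun M hM w v => (h M hM w v).1, fun M hM w v => (h M hM w v).2⟩,
    fun h M hM w v => ⟨h.1 M hM w v, h.2 M hM w v⟩⟩

theorem models_geomImp {s s' : Finset ℕ} {B B' : BuiltinC L} :
    CT.Models (geomImp s B s' B') ↔ ∀ (p : ModelPoint CT) (v v₁ : ℕ → p.Dom),
      (∀ x ∉ s, v₁ x = v x) → Sat v₁ B.atoms → ∃ v₂, (∀ x ∉ s', v₂ x = v x) ∧ Sat v₂ B'.atoms := by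
  simp only [geomImp, models_imp, forces_exs, forces_builtin, forall_exists_index, and_imp]

theorem mem_strictLocals {U : UserC L C} {B : BuiltinC L} {V : Finset ℕ} {x : ℕ} :
    x ∈ strictLocals U B V ↔ x ∈ bvars B.atoms ∧ x ∉ V ∧ x ∉ uvars U.atoms := by
  simp only [strictLocals, Finset.mem_sdiff, Finset.mem_union, ← UserC.mem_vars,
    ← BuiltinC.mem_vars]
  tauto

/-- The quantifiers over strictly local variables in terms of valuations: only the values of the
global variables and of the variables of the user-defined constraint are kept. -/
theorem models_geomImp_strictLocals {U : UserC L C} {B B' : BuiltinC L} {V : Finset ℕ} :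
    CT.Models (geomImp (strictLocals U B V) B (strictLocals U B' V) B') ↔
      ∀ (p : ModelPoint CT) (v : ℕ → p.Dom), Sat v B.atoms →
        ∃ v', (∀ x, x ∈ uvars U.atoms ∨ x ∈ V → v' x = v x) ∧ Sat v' B'.atoms := by
  rw [models_geomImp]
  constructor
  · intro h p v hv
    obtain ⟨v', h', hs⟩ := h p v v (fun _ _ => rfl) hv
    refine ⟨v', fun x hx => h' x ?_, hs⟩
    rw [mem_strictLocals]
    tauto
  · intro h p v v₁ h₁ hv
    obtain ⟨v₂, h₂, hs⟩ := h p v₁ hv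
    classical
    refine ⟨fun x => if x ∈ strictLocals U B' V then v₂ x else v x, fun x hx => if_neg hx,
      (sat_congr fun x hx => ?_).1 hs⟩
    by_cases hl : x ∈ strictLocals U B' V
    · simp [hl]
    · have hx' : x ∈ uvars U.atoms ∨ x ∈ V := by
        rw [mem_strictLocals] at hl
        tauto
      rw [if_neg hl, h₂ x hx', h₁]
      rw [mem_strictLocals]
      tauto

end Forces

/-! ### State classes presented by multisets -/

/-- The class of the state with user-defined atoms `u`, built-in atoms `b` and global variables
`V`. -/
noncomputable def cfg (CT : ConstraintTheory L) (u : Multiset (UserAtom L C))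
    (b : Multiset (BuiltinAtom L)) (V : Finset ℕ) : StateClass C CT :=
  State.cls CT (.normal (Conj.ofMultiset u) (Conj.ofMultiset b) V)

section cfg

variable {CT : ConstraintTheory L} {u u' : Multiset (UserAtom L C)}
  {b b' : Multiset (BuiltinAtom L)} {V V' : Finset ℕ}

theorem cls_eq_of_equiv {S T : State L C} (h : StateEquiv CT S T) : S.cls CT = T.cls CT :=
  Quotient.sound h

theorem cls_eq_iff {S T : State L C} : S.cls CT = T.cls CT ↔ StateEquiv CT S T :=
  ⟨fun h => Quotient.exact h, cls_eq_of_equiv⟩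

@[simp]
theorem users_normal (U : UserC L C) (B : BuiltinC L) (V : Finset ℕ) :
    Goal.users (State.normal U B V).store = U.atoms := by
  simp [State.normal, Goal.users]

@[simp]
theorem builtins_normal (U : UserC L C) (B : BuiltinC L) (V : Finset ℕ) :
    Goal.builtins (State.normal U B V).store = B.atoms := by
  simp [State.normal, Goal.builtins]

theorem cls_eq_cfg (S : State L C) :
    S.cls CT = cfg CT (Goal.users S.store) (Goal.builtins S.store) S.glob := by
  refine cls_eq_of_equiv (.goal (G := S.store) S.glob (Conj.equiv_iff_atoms_eq.2 ?_))
  simp [Goal.atoms_eq, Conj.atoms]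

theorem cls_normal (U : UserC L C) (B : BuiltinC L) (V : Finset ℕ) :
    State.cls CT (.normal U B V) = cfg CT U.atoms B.atoms V := by
  rw [cls_eq_cfg, users_normal, builtins_normal]
  rfl

/-- Entailment by the theory, with the quantifiers over strictly local variables replaced by a change
of valuation. -/
theorem cfg_weaken (h : ∀ (p : ModelPoint CT) (v : ℕ → p.Dom), Sat v b →
      ∃ v', (∀ x, x ∈ uvars u ∨ x ∈ V → v' x = v x) ∧ Sat v' b') :
    StateEntails CT (cfg CT u b V) (cfg CT u b' V) :=
  .weaken _ _ _ _ (models_geomImp_strictLocals.2 (by simpa using h))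

theorem cfg_theory
    (h : ∀ (p : ModelPoint CT) (v : ℕ → p.Dom), Sat v b →
      ∃ v', (∀ x, x ∈ uvars u ∨ x ∈ V → v' x = v x) ∧ Sat v' b')
    (h' : ∀ (p : ModelPoint CT) (v : ℕ → p.Dom), Sat v b' →
      ∃ v', (∀ x, x ∈ uvars u ∨ x ∈ V → v' x = v x) ∧ Sat v' b) :
    cfg CT u b V = cfg CT u b' V :=
  cls_eq_of_equiv (.theory _ _ _ _ (models_iff.2
    ⟨models_geomImp_strictLocals.2 (by simpa using h),
      models_geomImp_strictLocals.2 (by simpa using h')⟩))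

theorem cfg_subst (x : ℕ) (t : L.Term ℕ) (h : .eq (.var x) t ∈ b) :
    cfg CT u b V = cfg CT (u.map (UserAtom.subst (single x t))) b V := by
  obtain ⟨b, rfl⟩ := Multiset.exists_cons_of_mem h
  have := cls_eq_of_equiv (CT := CT)
    (.subst (Conj.ofMultiset u) x t (Conj.ofMultiset b) V)
  simpa [cls_normal, UserC.subst, Conj.atoms] using this

theorem cfg_redundant {x : ℕ} (hu : x ∉ uvars u) (hb : x ∉ bvars b) :
    cfg CT u b (insert x V) = cfg CT u b V :=
  cls_eq_of_equiv (.redundant _ x V (by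
    rw [Goal.mem_vars]
    simpa [Goal.users, Goal.builtins] using ⟨hu, hb⟩))

theorem cfg_redundant_union {W : Finset ℕ} (h : ∀ x ∈ W, x ∉ V → x ∉ uvars u ∧ x ∉ bvars b) :
    cfg CT u b (W ∪ V) = cfg CT u b V := by
  induction W using Finset.induction_on with
  | empty => simp
  | insert x W _ ih =>
    have ih := ih fun y hy => h y (Finset.mem_insert_of_mem hy)
    rw [Finset.insert_union]
    by_cases hx : x ∈ V
    · rw [Finset.insert_eq_of_mem (Finset.mem_union_right _ hx), ih]
    · obtain ⟨hu, hb⟩ := h x (Finset.mem_insert_self _ _) hx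
      rw [cfg_redundant hu hb, ih]

theorem cfg_omit {W : Finset ℕ} : StateEntails CT (cfg CT u b (W ∪ V)) (cfg CT u b V) := by
  induction W using Finset.induction_on with
  | empty => simpa using .refl _
  | insert x W _ ih =>
    rw [Finset.insert_union]
    exact .trans (.omit_global _ _ x _) ih

theorem cfg_omit_of_subset (h : V' ⊆ V) : StateEntails CT (cfg CT u b V) (cfg CT u b V') := by
  have := cfg_omit (CT := CT) (u := u) (b := b) (W := V) (V := V')
  rwa [Finset.union_eq_left.2 h] at this

theorem cfg_failed_of_mem (h : .bot ∈ b) (h' : .bot ∈ b') : cfg CT u b V = cfg CT u' b' V' := by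
  obtain ⟨b, rfl⟩ := Multiset.exists_cons_of_mem h
  obtain ⟨b', rfl⟩ := Multiset.exists_cons_of_mem h'
  have := cls_eq_of_equiv (CT := CT) (.failed
    (State.normal (Conj.ofMultiset u) (Conj.ofMultiset b) V).store
    (State.normal (Conj.ofMultiset u') (Conj.ofMultiset b') V').store V V')
  simpa [cls_eq_cfg, Goal.users, Goal.builtins, Multiset.add_cons, add_comm _ {BuiltinAtom.bot}]
    using this

/-- An inconsistent built-in store: no model of the theory satisfies it. -/
def Failed (CT : ConstraintTheory L) (b : Multiset (BuiltinAtom L)) : Prop :=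
  ∀ (p : ModelPoint CT) (v : ℕ → p.Dom), ¬ Sat v b

/-- All inconsistent states are equivalent, since the theory allows their built-in store to be replaced
by falsity. -/
theorem cfg_failed (h : Failed CT b) (h' : Failed CT b') : cfg CT u b V = cfg CT u' b' V' := by
  have key : ∀ {u : Multiset (UserAtom L C)} {b V}, Failed CT b →
      cfg CT u b V = cfg CT u {.bot} V := fun h =>
    cfg_theory (fun p v hv => (h p v hv).elim) fun p v hv => (hv .bot (by simp)).elim
  rw [key h, key h']
  exact cfg_failed_of_mem (by simp) (by simp)

theorem cfg_failed_entails (h : Failed CT b) (X : StateClass C CT) :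
    StateEntails CT (cfg CT u b V) X := by
  obtain ⟨S, rfl⟩ := Quotient.exists_rep X
  change StateEntails CT _ (S.cls CT)
  rw [cls_eq_cfg, cfg_failed (u' := Goal.users S.store) (b' := .bot ::ₘ Goal.builtins S.store)
    (V' := S.glob) h fun p v hv => (hv .bot (by simp)).elim]
  exact cfg_weaken fun p v hv => ⟨v, fun _ _ => rfl, (sat_cons.1 hv).2⟩

/-- A complete theory proves the solvability of every consistent store. -/
theorem models_exClosure_of_not_failed (hCT : CT.IsComplete) {B : BuiltinC L}
    (h : ¬ Failed CT B.atoms) : CT.Models B.exClosure := by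
  refine (hCT B).resolve_right fun hn => h fun p v hv => ?_
  exact models_imp.1 hn p v ((forces_exs p).2 ⟨v, fun _ _ => rfl, (forces_builtin p).2 hv⟩)

/-- A transition on presented classes: it suffices that the store is consistent. -/
theorem cfg_step {P : Program L C} {r₀ r : Rule L C} (hr₀ : r₀ ∈ P) (hr : r₀.IsVariant r)
    (hloc : ∀ x ∈ r.locals, x ∉ uvars u ∧ x ∉ bvars b ∧ x ∉ V) (hCT : CT.IsComplete)
    (hb : ¬ Failed CT (r.guard.atoms + b)) :
    Step P CT (cfg CT (r.kept.atoms + (r.removed.atoms + u)) (r.guard.atoms + b) V)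
      (cfg CT (r.kept.atoms + (r.bodyU.atoms + u)) (r.guard.atoms + (r.bodyB.atoms + b)) V) := by
  have := Step.apply (P := P) (CT := CT) r₀ r (Conj.ofMultiset u) (Conj.ofMultiset b) V hr₀ hr ?_ ?_
  · simpa [cls_normal, Conj.atoms] using this
  · rw [Finset.disjoint_left]
    intro x hx
    have h := hloc x hx
    have hh : x ∉ r.kept.vars ∪ r.removed.vars := (Finset.mem_sdiff.1 hx).2
    rw [Finset.union_assoc, Finset.union_assoc, Finset.mem_union, not_or]
    refine ⟨hh, ?_⟩
    simpa [UserC.mem_vars, BuiltinC.mem_vars] using h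
  · exact models_exClosure_of_not_failed hCT (by simpa [Conj.atoms] using hb)

end cfg

/-! ### Semantic refinement of states -/

/-- Semantic counterpart of state entailment.  A state denotes, at each world of each model, the
values of its atomic user-defined constraints together with the values of its global variables;
values of variables outside `V` are arbitrary, which `ρ` expresses.  The relation `R` matches the
atoms of the two states, independently of the model. -/
def Refines (CT : ConstraintTheory L) (u : Multiset (UserAtom L C)) (b : Multiset (BuiltinAtom L))
    (V : Finset ℕ) (u' : Multiset (UserAtom L C)) (b' : Multiset (BuiltinAtom L))
    (V' : Finset ℕ) : Prop :=
  ∃ R : UserAtom L C → UserAtom L C → Prop, (Multiset.Rel R u u' ∨ Failed CT b) ∧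
    ∀ (p : ModelPoint CT) (v ρ : ℕ → p.Dom), Sat v b → (∀ x ∈ V, ρ x = v x) →
      ∃ v', Sat v' b' ∧ (∀ x ∈ V', v' x = ρ x) ∧ ∀ a a', R a a' → UserAtom.Agree v v' a a'

section Refines

variable {CT : ConstraintTheory L} {u u' u'' : Multiset (UserAtom L C)}
  {b b' b'' : Multiset (BuiltinAtom L)} {V V' V'' : Finset ℕ}

theorem rel_comp {α β γ : Type*} {R : α → β → Prop} {R' : β → γ → Prop}
    {s : Multiset α} {t : Multiset β} {w : Multiset γ} (h : Multiset.Rel R s t)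
    (h' : Multiset.Rel R' t w) : Multiset.Rel (Relation.Comp R R') s w := by
  induction h generalizing w with
  | zero => rw [Multiset.rel_zero_left.1 h']; exact .zero
  | cons hab _ ih =>
    obtain ⟨c, w', hbc, hw, rfl⟩ := Multiset.rel_cons_left.1 h'
    exact .cons ⟨_, hab, hbc⟩ (ih hw)

theorem Failed.refines (h : Failed CT b) : Refines CT u b V u' b' V' :=
  ⟨fun _ _ => False, .inr h, fun p v _ hv => (h p v hv).elim⟩

theorem Refines.trans (h : Refines CT u b V u' b' V') (h' : Refines CT u' b' V' u'' b'' V'') :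
    Refines CT u b V u'' b'' V'' := by
  obtain ⟨R, hR, h⟩ := h
  obtain ⟨R', hR', h'⟩ := h'
  by_cases hb : Failed CT b
  · exact hb.refines
  have hb' : ¬ Failed CT b' := by
    simp only [Failed, not_forall, not_not] at hb ⊢
    obtain ⟨p, v, hv⟩ := hb
    obtain ⟨v', hv', -⟩ := h p v v hv fun _ _ => rfl
    exact ⟨p, v', hv'⟩
  refine ⟨Relation.Comp R R', .inl (rel_comp (hR.resolve_right hb) (hR'.resolve_right hb')), ?_⟩
  intro p v ρ hv hρ
  obtain ⟨v', hv', hρ', ha⟩ := h p v ρ hv hρ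
  obtain ⟨v'', hv'', hρ'', ha'⟩ := h' p v' ρ hv' fun x hx => (hρ' x hx).symm
  exact ⟨v'', hv'', hρ'', fun a c ⟨b, hab, hbc⟩ => (ha a b hab).trans (ha' b c hbc)⟩

/-- Refinement between states with the same user-defined atoms. -/
theorem Refines.of_same_users
    (h : ∀ (p : ModelPoint CT) (v ρ : ℕ → p.Dom), Sat v b → (∀ x ∈ V, ρ x = v x) →
      ∃ v', Sat v' b' ∧ (∀ x ∈ V', v' x = ρ x) ∧ ∀ x ∈ uvars u, v x = v' x) :
    Refines CT u b V u b' V' := by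
  refine ⟨fun a a' => a = a' ∧ a ∈ u, .inl (Multiset.rel_refl_of_refl_on fun a ha => ⟨rfl, ha⟩), ?_⟩
  intro p v ρ hv hρ
  obtain ⟨v', hv', hρ', h⟩ := h p v ρ hv hρ
  refine ⟨v', hv', hρ', ?_⟩
  rintro a _ ⟨rfl, ha⟩
  exact .of_eqOn fun x hx => h x ⟨a, ha, hx⟩

theorem Refines.of_weaken (h : ∀ (p : ModelPoint CT) (v : ℕ → p.Dom), Sat v b →
      ∃ v', (∀ x, x ∈ uvars u ∨ x ∈ V → v' x = v x) ∧ Sat v' b') : Refines CT u b V u b' V := by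
  refine .of_same_users fun p v ρ hv hρ => ?_
  obtain ⟨v', hv', hs⟩ := h p v hv
  exact ⟨v', hs, fun x hx => (hv' x (.inr hx)).trans (hρ x hx).symm, fun x hx =>
    (hv' x (.inl hx)).symm⟩

/-- Refinement of states, through the atoms of their goals. -/
def State.Refines (CT : ConstraintTheory L) (S T : State L C) : Prop :=
  CHR.Refines CT (Goal.users S.store) (Goal.builtins S.store) S.glob
    (Goal.users T.store) (Goal.builtins T.store) T.glob

theorem State.Refines.refl (S : State L C) : S.Refines CT S :=
  .of_same_users fun _ v _ hv hρ => ⟨v, hv, fun x hx => (hρ x hx).symm, fun _ _ => rfl⟩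

theorem realize_single {D : Type*} [L.Structure D] {v : ℕ → D} {x : ℕ} {t : L.Term ℕ}
    (h : v x = t.realize v) (y : ℕ) : (single x t y).realize v = v y := by
  unfold single
  by_cases hy : y = x
  · subst hy; simp [h]
  · simp [Function.update_of_ne hy]

theorem StateEquiv.refines {S T : State L C} (h : StateEquiv CT S T) :
    S.Refines CT T ∧ T.Refines CT S := by
  induction h with
  | refl S => exact ⟨.refl S, .refl S⟩
  | symm _ ih => exact ih.symm
  | trans _ _ ih ih' => exact ⟨ih.1.trans ih'.1, ih'.2.trans ih.2⟩
  | @goal G G' V h =>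
    unfold State.Refines
    rw [Goal.users_eq_of_equiv h, Goal.builtins_eq_of_equiv h]
    exact ⟨State.Refines.refl ⟨G', V⟩, State.Refines.refl ⟨G', V⟩⟩
  | subst U x t B V =>
    unfold State.Refines
    simp only [users_normal, builtins_normal, UserC.subst, Conj.atoms_map]
    have key : ∀ {D : Type u} [L.Structure D] (v : ℕ → D),
        Sat v (Conj.and (.atom (.eq (.var x) t)) B).atoms → v x = t.realize v := fun v hv => by
      simpa [BuiltinAtom.Holds] using hv (.eq (.var x) t) (by simp [Conj.atoms])
    constructor
    · refine ⟨fun a a' => a' = a.subst (single x t), .inl ?_, fun p v _ hv hρ =>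
        ⟨v, hv, fun x hx => (hρ x hx).symm, ?_⟩⟩
      · rw [Multiset.rel_map_right]
        exact Multiset.rel_refl_of_refl_on fun _ _ => rfl
      · rintro a _ rfl
        exact (UserAtom.Agree.of_subst _ fun y _ => realize_single (key v hv) y).symm
    · refine ⟨fun a a' => a = a'.subst (single x t), .inl ?_, fun p v _ hv hρ =>
        ⟨v, hv, fun x hx => (hρ x hx).symm, ?_⟩⟩
      · rw [Multiset.rel_map_left]
        exact Multiset.rel_refl_of_refl_on fun _ _ => rfl
      · rintro _ a rfl
        exact UserAtom.Agree.of_subst _ fun y _ => realize_single (key v hv) y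
  | theory U B B' V h =>
    unfold State.Refines
    simp only [users_normal, builtins_normal]
    rw [models_iff] at h
    exact ⟨.of_weaken (models_geomImp_strictLocals.1 h.1),
      .of_weaken (models_geomImp_strictLocals.1 h.2)⟩
  | redundant G x V h =>
    rw [Goal.mem_vars, not_or] at h
    constructor
    · exact .of_same_users fun p v _ hv hρ =>
        ⟨v, hv, fun x hx => (hρ x (Finset.mem_insert_of_mem hx)).symm, fun _ _ => rfl⟩
    · refine .of_same_users fun p v ρ hv hρ =>
        ⟨Function.update v x (ρ x), ?_, fun y hy => ?_, fun y hy => ?_⟩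
      · refine (sat_congr fun y hy => ?_).1 hv
        rw [Function.update_of_ne]
        exact fun h' => h.2 (h' ▸ hy)
      · by_cases h' : y = x
        · subst h'; simp
        · rw [Function.update_of_ne h']
          exact (hρ y ((Finset.mem_insert.1 hy).resolve_left h')).symm
      · rw [Function.update_of_ne]
        exact fun h' => h.1 (h' ▸ hy)
  | failed G G' V V' =>
    have key : ∀ G : Goal L C, Failed CT (Goal.builtins (.and G (.atom (.inr .bot)))) :=
      fun G p v hv => hv .bot (by simp [Goal.builtins])
    exact ⟨(key G).refines, (key G').refines⟩

/-- State entailment is sound for semantic refinement. -/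
theorem StateEntails.refines {X Y : StateClass C CT} (h : StateEntails CT X Y) :
    ∀ S T : State L C, S.cls CT = X → T.cls CT = Y → S.Refines CT T := by
  induction h with
  | refl X =>
    intro S T hS hT
    exact (cls_eq_iff.1 (hS.trans hT.symm)).refines.1
  | @trans X Y Z _ _ ih ih' =>
    intro S T hS hT
    obtain ⟨M, hM⟩ := Quotient.exists_rep Y
    exact (ih S M hS hM).trans (ih' M T hM hT)
  | weaken U B B' V h =>
    intro S T hS hT
    refine (cls_eq_iff.1 hS).refines.1.trans (.trans ?_ (cls_eq_iff.1 hT).refines.2)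
    simp only [users_normal, builtins_normal]
    exact .of_weaken (models_geomImp_strictLocals.1 h)
  | omit_global U B x V =>
    intro S T hS hT
    refine (cls_eq_iff.1 hS).refines.1.trans (.trans ?_ (cls_eq_iff.1 hT).refines.2)
    simp only [users_normal, builtins_normal]
    exact .of_same_users fun p v _ hv hρ =>
        ⟨v, hv, fun x hx => (hρ x (Finset.mem_insert_of_mem hx)).symm, fun _ _ => rfl⟩

theorem cfg_refines (h : StateEntails CT (cfg CT u b V) (cfg CT u' b' V')) :
    Refines CT u b V u' b' V' := by
  simpa [State.Refines, State.normal, Goal.users, Goal.builtins] using h.refines _ _ rfl rfl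

end Refines

/-! ### Replacing provably equal arguments -/

section Replace

variable {CT : ConstraintTheory L} {u u' : Multiset (UserAtom L C)}
  {b b' : Multiset (BuiltinAtom L)} {V V' : Finset ℕ}

theorem single_self (x : ℕ) (t : L.Term ℕ) : single x t x = t := Function.update_self _ _ _

theorem single_of_ne {x y : ℕ} (h : y ≠ x) (t : L.Term ℕ) : single x t y = .var y :=
  Function.update_of_ne h _ _

theorem term_subst_single_of_notMem {x : ℕ} {s t : L.Term ℕ} (h : x ∉ t.varFinset) :
    t.subst (single x s) = t := by
  conv_rhs => rw [← term_subst_var t]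
  refine term_subst_congr fun y hy => single_of_ne ?_ s
  rintro rfl
  exact h hy

/-- A term in the user-defined atoms may be abstracted by a fresh variable. -/
theorem cfg_abstract {z : ℕ} {s : L.Term ℕ} (hb : z ∉ bvars b) (hV : z ∉ V)
    (hs : z ∉ s.varFinset) :
    cfg CT (u.map (UserAtom.subst (single z s))) b V = cfg CT u (.eq (.var z) s ::ₘ b) V := by
  rw [cfg_subst (u := u) z s (Multiset.mem_cons_self _ _)]
  refine cfg_theory (fun p v hv => ⟨Function.update v z (s.realize v), fun x hx => ?_, ?_⟩)
    fun p v hv => ⟨v, fun _ _ => rfl, (sat_cons.1 hv).2⟩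
  · refine Function.update_of_ne ?_ _ _
    rintro rfl
    refine hx.elim (fun h => ?_) hV
    obtain ⟨y, -, hy⟩ := mem_uvars_map_subst.1 h
    by_cases h : y = x
    · subst h; rw [single_self] at hy; exact hs hy
    · rw [single_of_ne h] at hy
      simp only [Term.varFinset, Finset.mem_singleton] at hy
      exact h hy.symm
  · refine sat_cons.2 ⟨?_, (sat_congr fun x hx => ?_).1 hv⟩
    · simp only [BuiltinAtom.Holds, Term.realize, Function.update_self]
      refine realize_congr fun x hx => (Function.update_of_ne ?_ _ _).symm
      exact fun h => hs (h ▸ hx)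
    · refine (Function.update_of_ne ?_ _ _).symm
      rintro rfl
      exact hb hx

theorem cfg_replace_single {z : ℕ} {s t : L.Term ℕ} (hb : z ∉ bvars b) (hV : z ∉ V)
    (hs : z ∉ s.varFinset) (ht : z ∉ t.varFinset)
    (h : ∀ (p : ModelPoint CT) (v : ℕ → p.Dom), Sat v b → s.realize v = t.realize v) :
    cfg CT (u.map (UserAtom.subst (single z s))) b V =
      cfg CT (u.map (UserAtom.subst (single z t))) b V := by
  rw [cfg_abstract hb hV hs, cfg_abstract hb hV ht]
  refine cfg_theory (fun p v hv => ⟨v, fun _ _ => rfl, ?_⟩) fun p v hv => ⟨v, fun _ _ => rfl, ?_⟩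
  all_goals
    rw [sat_cons] at hv ⊢
    refine ⟨?_, hv.2⟩
    have := h p v hv.2
    have h' := hv.1
    simp only [BuiltinAtom.Holds] at h' ⊢
    simp [h', this]

theorem exists_bound {s : Set ℕ} (h : s.Finite) : ∃ N, ∀ x ∈ s, x < N := by
  obtain ⟨N, hN⟩ := h.bddAbove
  exact ⟨N + 1, fun x hx => Nat.lt_succ_of_le (hN hx)⟩

/-- Two instances of the same atoms, under substitutions that the store makes equal, are
interchangeable.  The variables are treated one at a time. -/
theorem cfg_replace {σ τ : ℕ → L.Term ℕ} (s : Finset ℕ) (hs : ∀ x ∉ s, σ x = τ x)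
    (h : ∀ (p : ModelPoint CT) (v : ℕ → p.Dom), Sat v b →
      ∀ x ∈ s, (σ x).realize v = (τ x).realize v) :
    cfg CT (u.map (UserAtom.subst σ)) b V = cfg CT (u.map (UserAtom.subst τ)) b V := by
  induction s using Finset.induction_on generalizing σ with
  | empty => rw [funext fun x => hs x (by simp)]
  | insert x s _ ih =>
    have hσ : cfg CT (u.map (UserAtom.subst σ)) b V =
        cfg CT (u.map (UserAtom.subst (Function.update σ x (τ x)))) b V := by
      -- Both instances are instances of the one that sends `x` to the fresh variable `z`.
      obtain ⟨z, hz⟩ := exists_bound <|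
        (bvars_finite b).union <| V.finite_toSet.union <|
          (σ x).varFinset.finite_toSet.union <| (τ x).varFinset.finite_toSet.union <|
            uvars_finite (u.map (UserAtom.subst σ))
      have key : ∀ t : L.Term ℕ, u.map (UserAtom.subst (Function.update σ x t)) =
          (u.map (UserAtom.subst (Function.update σ x (.var z)))).map
            (UserAtom.subst (single z t)) := by
        intro t
        rw [Multiset.map_map]
        refine Multiset.map_congr rfl fun a ha => ?_
        rw [Function.comp_apply, UserAtom.subst_subst]
        refine UserAtom.subst_congr fun y hy => ?_
        by_cases hyx : y = x
        · subst hyx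
          simp [Term.subst, single_self]
        · simp only [Function.update_of_ne hyx]
          refine (term_subst_single_of_notMem fun hzy => (hz z ?_).false).symm
          exact .inr <| .inr <| .inr <| .inr <| mem_uvars_map_subst.2 ⟨y, ⟨a, ha, hy⟩, hzy⟩
      have key' := key (σ x)
      rw [Function.update_eq_self] at key'
      rw [key', key (τ x)]
      exact cfg_replace_single (fun h => (hz z (.inl h)).false)
        (fun h => (hz z (.inr (.inl h))).false) (fun h => (hz z (.inr (.inr (.inl h)))).false)
        (fun h => (hz z (.inr (.inr (.inr (.inl h))))).false)
        fun p v hv => h p v hv x (Finset.mem_insert_self _ _)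
    rw [hσ]
    refine ih (fun y hy => ?_) fun p v hv y hy => ?_
    · by_cases hyx : y = x
      · subst hyx; simp
      · rw [Function.update_of_ne hyx]
        exact hs y (by simp [hyx, hy])
    · by_cases hyx : y = x
      · subst hyx; simp
      · rw [Function.update_of_ne hyx]
        exact h p v hv y (Finset.mem_insert_of_mem hy)

theorem cfg_replace_atom {n : ℕ} (c : C n) {ts ts' : Fin n → L.Term ℕ}
    (h : ∀ (p : ModelPoint CT) (v : ℕ → p.Dom), Sat v b →
      ∀ i, (ts i).realize v = (ts' i).realize v) :
    cfg CT (.mk c ts ::ₘ u) b V = cfg CT (.mk c ts' ::ₘ u) b V := by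
  obtain ⟨N, hN⟩ := exists_bound (uvars_finite u)
  -- Both sides are instances of a pattern whose arguments are the variables `N, …, N + n - 1`.
  let σ : (Fin n → L.Term ℕ) → ℕ → L.Term ℕ := fun ts x =>
    if h : N ≤ x ∧ x - N < n then ts ⟨x - N, h.2⟩ else .var x
  have key : ∀ ts, (UserAtom.mk c ts ::ₘ u : Multiset (UserAtom L C)) =
      (UserAtom.mk c (fun i => .var (N + i)) ::ₘ u).map (UserAtom.subst (σ ts)) := by
    intro ts
    rw [Multiset.map_cons]
    congr 1
    · simp [UserAtom.subst, Term.subst, σ]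
    · conv_lhs => rw [← Multiset.map_id u]
      refine Multiset.map_congr rfl fun a ha => ?_
      rw [id, ← UserAtom.subst_var a, UserAtom.subst_subst]
      refine UserAtom.subst_congr fun x hx => ?_
      have := hN x ⟨a, ha, hx⟩
      simp [Term.subst, σ, not_le.2 this]
  rw [key ts, key ts']
  refine cfg_replace (Finset.Ico N (N + n)) (fun x hx => ?_) fun p v hv x hx => ?_
  · have : ¬ (N ≤ x ∧ x - N < n) := by
      rw [Finset.mem_Ico] at hx
      omega
    simp [σ, this]
  · have : N ≤ x ∧ x - N < n := by
      rw [Finset.mem_Ico] at hx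
      omega
    simp only [σ, dif_pos this]
    exact h p v hv _

/-- For a matching of two multisets of atoms there is a built-in store, the conjunction of the
equations between matched arguments, in the presence of which one may replace the other. -/
theorem exists_equations {R : UserAtom L C → UserAtom L C → Prop} (h : Multiset.Rel R u u')
    (hR : ∀ a ∈ u, ∀ a' ∈ u', R a a' → ∃ (n : ℕ) (c : C n) (ts ts' : Fin n → L.Term ℕ),
      a = .mk c ts ∧ a' = .mk c ts') :
    ∃ e : Multiset (BuiltinAtom L), bvars e ⊆ uvars u ∪ uvars u' ∧
      (∀ (p : ModelPoint CT) (v : ℕ → p.Dom),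
        (∀ a ∈ u, ∀ a' ∈ u', R a a' → UserAtom.Agree v v a a') → Sat v e) ∧
      ∀ b k V, (∀ (p : ModelPoint CT) (v : ℕ → p.Dom), Sat v b → Sat v e) →
        cfg CT (u + k) b V = cfg CT (u' + k) b V := by
  induction h with
  | zero => exact ⟨0, by simp [bvars], by simp [Sat], fun _ _ _ _ => rfl⟩
  | @cons a a' u u' haa _ ih =>
    obtain ⟨n, c, ts, ts', rfl, rfl⟩ := hR _ (Multiset.mem_cons_self _ _) _
      (Multiset.mem_cons_self _ _) haa
    obtain ⟨e, he, hs, hc⟩ := ih fun a ha a' ha' => hR a (Multiset.mem_cons_of_mem ha) a'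
      (Multiset.mem_cons_of_mem ha')
    refine ⟨Multiset.ofList (List.ofFn fun i => .eq (ts i) (ts' i)) + e, ?_, ?_, ?_⟩
    · rw [bvars_add, uvars_cons, uvars_cons]
      apply Set.union_subset
      · rintro x ⟨a, ha, hx⟩
        simp only [Multiset.mem_coe, List.mem_ofFn] at ha
        obtain ⟨i, rfl⟩ := ha
        simp only [BuiltinAtom.vars, Finset.mem_union] at hx
        exact hx.imp (fun h => .inl (UserAtom.mem_vars_mk.2 ⟨i, h⟩))
          fun h => .inl (UserAtom.mem_vars_mk.2 ⟨i, h⟩)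
      · intro x hx
        exact (he hx).imp .inr .inr
    · intro p v hv
      rw [sat_add]
      refine ⟨?_, hs p v fun a ha a' ha' => hv a (Multiset.mem_cons_of_mem ha) a'
        (Multiset.mem_cons_of_mem ha')⟩
      intro a ha
      simp only [Multiset.mem_coe, List.mem_ofFn] at ha
      obtain ⟨i, rfl⟩ := ha
      have := hv _ (Multiset.mem_cons_self _ _) _ (Multiset.mem_cons_self _ _) haa
      cases this with
      | mk _ _ _ h => exact h i
    · intro b k V hb
      rw [Multiset.cons_add, Multiset.cons_add, cfg_replace_atom c (ts' := ts'),
        ← Multiset.add_cons, ← Multiset.add_cons]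
      · exact hc b _ V fun p v hv => (sat_add.1 (hb p v hv)).2
      · intro p v hv i
        exact (sat_add.1 (hb p v hv)).1 (.eq (ts i) (ts' i))
          (Multiset.mem_coe.2 (List.mem_ofFn.2 ⟨i, rfl⟩))

end Replace

/-! ### Renaming local variables -/

section Rename

variable {CT : ConstraintTheory L} {u u' : Multiset (UserAtom L C)}
  {b b' : Multiset (BuiltinAtom L)} {V V' : Finset ℕ} {f : ℕ → ℕ}

theorem mem_uvars_rename {y : ℕ} :
    y ∈ uvars (u.map (UserAtom.subst (renameVar f))) ↔ ∃ x ∈ uvars u, f x = y := by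
  simp [mem_uvars_map_subst, renameVar, Term.varFinset, eq_comm]

theorem mem_bvars_rename {y : ℕ} :
    y ∈ bvars (b.map (BuiltinAtom.subst (renameVar f))) ↔ ∃ x ∈ bvars b, f x = y := by
  simp [mem_bvars_map_subst, renameVar, Term.varFinset, eq_comm]

theorem sat_rename {D : Type*} [L.Structure D] {v : ℕ → D} :
    Sat v (b.map (BuiltinAtom.subst (renameVar f))) ↔ Sat (fun x => v (f x)) b :=
  sat_subst

/-- A valuation with prescribed values at renamed variables and at all other variables. -/
theorem exists_transport {D : Type*} (hf : f.Injective) (X : Set ℕ) (g h : ℕ → D) :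
    ∃ v : ℕ → D, (∀ x ∈ X, v (f x) = g x) ∧ ∀ y, (∀ x ∈ X, f x ≠ y) → v y = h y := by
  classical
  refine ⟨fun y => if hy : ∃ x ∈ X, f x = y then g hy.choose else h y, fun x hx => ?_,
    fun y hy => dif_neg fun ⟨x, hx, h⟩ => hy x hx h⟩
  have hy : ∃ x' ∈ X, f x' = f x := ⟨x, hx, rfl⟩
  simp only [dif_pos hy]
  exact congrArg g (hf hy.choose_spec.2)

/-- An injective renaming of the local variables by fresh ones does not change the class. -/
theorem cfg_rename (hf : f.Injective) (hV : ∀ x ∈ V, f x = x)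
    (hu : ∀ x ∉ V, f x ∉ uvars u) (hb : ∀ x ∉ V, f x ∉ bvars b) :
    cfg CT (u.map (UserAtom.subst (renameVar f))) (b.map (BuiltinAtom.subst (renameVar f))) V =
      cfg CT u b V := by
  classical
  obtain ⟨X, hX⟩ : ∃ X : Finset ℕ, ∀ x, x ∈ X ↔ (x ∈ uvars u ∨ x ∈ bvars b) ∧ x ∉ V := by
    have hfin : ((uvars u ∪ bvars b) \ V : Set ℕ).Finite :=
      ((uvars_finite u).union (bvars_finite b)).sdiff
    exact ⟨hfin.toFinset, fun x => by simp⟩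
  have hfV : ∀ x ∉ V, f x ∉ V := fun x hx h => hx (hf (hV _ h) ▸ h)
  have hfX : ∀ x ∈ X, ∀ y, y ∈ uvars u ∨ y ∈ bvars b ∨ y ∈ V → f x ≠ y := by
    rintro x hx _ h rfl
    have hx := ((hX x).1 hx).2
    exact h.elim (hu x hx) fun h => h.elim (hb x hx) (hfV x hx)
  let e : Multiset (BuiltinAtom L) := X.val.map fun x => .eq (.var x) (.var (f x))
  have he : ∀ {D : Type u} [L.Structure D] (v : ℕ → D), Sat v e ↔ ∀ x ∈ X, v x = v (f x) := by
    intro D _ v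
    simp [Sat, e, BuiltinAtom.Holds]
  -- The equations `x = f x` are added to the store, applied, and removed together with the old
  -- names.
  have h₁ : cfg CT u b V = cfg CT u (b + e) V := by
    refine cfg_theory (fun p v hv => ?_) fun p v hv => ⟨v, fun _ _ => rfl, (sat_add.1 hv).1⟩
    obtain ⟨v', hv', hv''⟩ := exists_transport hf (X : Set ℕ) v v
    have hag : ∀ y, y ∈ uvars u ∨ y ∈ bvars b ∨ y ∈ V → v' y = v y := fun y hy =>
      hv'' y fun x hx => hfX x hx y hy
    refine ⟨v', fun x hx => hag x (by tauto), sat_add.2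
      ⟨(sat_congr fun x hx => hag x (by tauto)).2 hv, (he v').2 fun x hx => ?_⟩⟩
    rw [hv' x hx]
    have := ((hX x).1 hx).1
    exact hag x (by tauto)
  have h₂ : cfg CT u (b + e) V =
      cfg CT (u.map (UserAtom.subst (renameVar f))) (b + e) V := by
    have := cfg_replace (CT := CT) (u := u) (b := b + e) (V := V) (σ := Term.var)
      (τ := fun x => if x ∈ X then .var (f x) else .var x) X (fun x hx => by simp [hx])
      fun p v hv x hx => by simpa [hx] using (he v).1 (sat_add.1 hv).2 x hx
    rw [show u.map (UserAtom.subst Term.var) = u by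
      rw [funext UserAtom.subst_var]; exact Multiset.map_id u] at this
    rw [this]
    congr 1
    refine Multiset.map_congr rfl fun a ha => UserAtom.subst_congr fun x hx => ?_
    by_cases h : x ∈ X
    · simp [h, renameVar]
    · have hxV : x ∈ V := by
        by_contra hxV
        exact h ((hX x).2 ⟨.inl ⟨a, ha, hx⟩, hxV⟩)
      simp [h, renameVar, hV x hxV]
  rw [h₁, h₂]
  refine (cfg_theory (fun p v hv => ⟨v, fun _ _ => rfl, ?_⟩) fun p v hv =>
    ⟨fun x => if x ∈ X then v (f x) else v x, fun x hx => if_neg ?_, ?_⟩).symm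
  · rw [sat_add, he] at hv
    rw [sat_rename]
    refine (sat_congr fun x hx => ?_).1 hv.1
    by_cases h : x ∈ V
    · rw [hV x h]
    · exact hv.2 x ((hX x).2 ⟨.inr hx, h⟩)
  · intro hxX
    obtain ⟨hx', hxV⟩ := (hX x).1 hxX
    obtain ⟨y, hy, rfl⟩ := mem_uvars_rename.1 (hx.resolve_right hxV)
    have hyV : y ∉ V := fun h => hxV ((hV y h).symm ▸ h)
    exact hx'.elim (hu y hyV) (hb y hyV)
  · rw [sat_rename] at hv
    rw [sat_add, he]
    refine ⟨(sat_congr fun x hx => ?_).1 hv, fun x hx => ?_⟩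
    · by_cases h : x ∈ X
      · simp [h]
      · have hxV : x ∈ V := by
          by_contra hxV
          exact h ((hX x).2 ⟨.inr hx, hxV⟩)
        simp [h, hV x hxV]
    · have : f x ∉ X := fun h => hfX x hx (f x) (by have := ((hX _).1 h).1; tauto) rfl
      simp [hx, this]

/-- There are injective renamings that fix a finite set and otherwise avoid another one. -/
theorem exists_renaming (V : Finset ℕ) {A : Set ℕ} (hA : A.Finite) :
    ∃ f : ℕ → ℕ, f.Injective ∧ (∀ x ∈ V, f x = x) ∧ ∀ x ∉ V, f x ∉ A := by
  obtain ⟨N, hN⟩ := exists_bound (hA.union V.finite_toSet)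
  have hV : ∀ x ∈ V, x < N := fun x hx => hN x (.inr hx)
  refine ⟨fun x => if x ∈ V then x else x + N, fun x y h => ?_, fun x hx => if_pos hx,
    fun x hx h => ?_⟩
  · simp only at h
    split_ifs at h with hx hy hy
    · exact h
    · have := hV x hx; omega
    · have := hV y hy; omega
    · omega
  · simp only [if_neg hx] at h
    have := hN _ (.inl h)
    omega

/-- The set of global variables may be enlarged at will after a renaming. -/
theorem exists_cfg_eq_union (CT : ConstraintTheory L) (u : Multiset (UserAtom L C))
    (b : Multiset (BuiltinAtom L)) (V W : Finset ℕ) :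
    ∃ f : ℕ → ℕ, (∀ x ∈ V, f x = x) ∧ cfg CT u b V =
      cfg CT (u.map (UserAtom.subst (renameVar f))) (b.map (BuiltinAtom.subst (renameVar f)))
        (W ∪ V) := by
  obtain ⟨f, hf, hV, hA⟩ := exists_renaming V
    ((uvars_finite u).union ((bvars_finite b).union W.finite_toSet))
  refine ⟨f, hV, ?_⟩
  have key : ∀ x ∈ W, x ∉ V → ∀ y, f y ≠ x := by
    rintro x hx hxV y rfl
    by_cases hy : y ∈ V
    · exact hxV ((hV y hy).symm ▸ hy)
    · exact hA y hy (.inr (.inr hx))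
  rw [cfg_redundant_union, cfg_rename hf hV (fun x hx h => hA x hx (.inl h))
    fun x hx h => hA x hx (.inr (.inl h))]
  intro x hx hxV
  rw [mem_uvars_rename, mem_bvars_rename]
  exact ⟨fun ⟨y, _, h⟩ => key x hx hxV y h, fun ⟨y, _, h⟩ => key x hx hxV y h⟩

/-! ### Completeness of semantic refinement -/

/-- A state can be written as a fresh copy of any state that it refines, with further built-in
constraints. -/
theorem Refines.exists_cfg_eq (h : Refines CT u b V u' b' V') (hF : ¬ Failed CT b) (hVV : V' ⊆ V)
    (hf : f.Injective) (hV : ∀ x ∈ V', f x = x)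
    (hA : ∀ x ∉ V', f x ∉ uvars u ∧ f x ∉ bvars b ∧ f x ∉ V) :
    ∃ e : Multiset (BuiltinAtom L),
      bvars e ⊆ uvars u ∪ bvars b ∪ uvars (u'.map (UserAtom.subst (renameVar f))) ∧
      cfg CT u b V = cfg CT (u'.map (UserAtom.subst (renameVar f)))
        (b'.map (BuiltinAtom.subst (renameVar f)) + e) V := by
  obtain ⟨R, hR, h⟩ := h
  have hR := hR.resolve_right hF
  have hsym : ∀ a a', R a a' → ∃ (n : ℕ) (c : C n) (ts ts' : Fin n → L.Term ℕ),
      a = .mk c ts ∧ a' = .mk c ts' := by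
    intro a a' haa
    simp only [Failed, not_forall, not_not] at hF
    obtain ⟨p, v, hv⟩ := hF
    obtain ⟨v', -, -, hag⟩ := h p v v hv fun _ _ => rfl
    obtain ⟨c, ts, ts', -⟩ := hag a a' haa
    exact ⟨_, c, ts, ts', rfl, rfl⟩
  let R' : UserAtom L C → UserAtom L C → Prop := fun a d =>
    ∃ a' ∈ u', R a a' ∧ d = a'.subst (renameVar f)
  have hR' : Multiset.Rel R' u (u'.map (UserAtom.subst (renameVar f))) := by
    rw [Multiset.rel_map_right]
    exact hR.mono fun a _ a' ha' haa => ⟨a', ha', haa, rfl⟩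
  obtain ⟨e, he, hes, hec⟩ := exists_equations (CT := CT) hR' (by
    rintro a - _ - ⟨a', -, haa, rfl⟩
    obtain ⟨n, c, ts, ts', rfl, rfl⟩ := hsym a a' haa
    exact ⟨n, c, ts, _, rfl, rfl⟩)
  refine ⟨b + e, ?_, ?_⟩
  · rw [bvars_add]
    refine Set.union_subset (fun x hx => .inl (.inr hx)) fun x hx => ?_
    exact (he hx).imp .inl id
  · have hadd : cfg CT u b V =
        cfg CT u (b'.map (BuiltinAtom.subst (renameVar f)) + (b + e)) V := by
      refine cfg_theory (fun p v hv => ?_) fun p v hv => ⟨v, fun _ _ => rfl,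
        (sat_add.1 (sat_add.1 hv).2).1⟩
      obtain ⟨v', hv', hρ, hag⟩ := h p v v hv fun _ _ => rfl
      -- The fresh copies take the values of the solution `v'`, all other variables keep theirs.
      obtain ⟨w, hw, hw'⟩ := exists_transport hf {x | x ∉ V'} v' v
      have hold : ∀ x, x ∈ uvars u ∨ x ∈ bvars b ∨ x ∈ V → w x = v x := by
        refine fun x hx => hw' x ?_
        rintro y hy rfl
        have := hA y hy
        tauto
      have hnew : ∀ x, w (f x) = v' x := by
        intro x
        by_cases hx : x ∈ V'
        · rw [hV x hx, hρ x hx, hold x (.inr (.inr (hVV hx)))]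
        · exact hw x hx
      refine ⟨w, fun x hx => hold x (by tauto), ?_⟩
      rw [sat_add, sat_add, sat_rename, funext hnew]
      refine ⟨hv', (sat_congr fun x hx => hold x (by tauto)).2 hv, hes p w ?_⟩
      rintro a ha _ - ⟨a', ha', haa, rfl⟩
      refine .trans (.of_eqOn fun x hx => hold x (.inl ⟨a, ha, hx⟩)) (.trans (hag a a' haa) ?_)
      exact (UserAtom.Agree.of_subst _ fun x _ => by simpa [renameVar] using hnew x).symm
    rw [hadd]
    simpa using hec (b'.map (BuiltinAtom.subst (renameVar f)) + (b + e)) 0 V fun p v hv =>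
      (sat_add.1 (sat_add.1 hv).2).2

theorem cfg_drop_right {e : Multiset (BuiltinAtom L)} :
    StateEntails CT (cfg CT u (b + e) V) (cfg CT u b V) :=
  cfg_weaken fun _ v hv => ⟨v, fun _ _ => rfl, (sat_add.1 hv).1⟩

/-- Semantic refinement is complete for state entailment. -/
theorem Refines.stateEntails (h : Refines CT u b V u' b' V') :
    StateEntails CT (cfg CT u b V) (cfg CT u' b' V') := by
  obtain ⟨g, -, hg⟩ := exists_cfg_eq_union CT u b V V'
  -- Global variables that are not global in the first state must not be confused with its local
  -- ones; this is why the latter are renamed first.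
  have hr := (cfg_refines (CT := CT) (by rw [← hg]; exact .refl _)).trans h
  rw [hg]
  generalize u.map (UserAtom.subst (renameVar g)) = u₁ at *
  generalize b.map (BuiltinAtom.subst (renameVar g)) = b₁ at *
  by_cases hF : Failed CT b₁
  · exact cfg_failed_entails hF _
  obtain ⟨f, hf, hV, hA⟩ := exists_renaming V'
    ((uvars_finite u₁).union ((bvars_finite b₁).union ((V' ∪ V).finite_toSet.union
      ((uvars_finite u').union (bvars_finite b')))))
  obtain ⟨e, -, he⟩ := hr.exists_cfg_eq hF Finset.subset_union_left hf hV fun x hx =>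
    ⟨fun h => hA x hx (.inl h), fun h => hA x hx (.inr (.inl h)),
      fun h => hA x hx (.inr (.inr (.inl h)))⟩
  rw [he, ← cfg_rename (u := u') (b := b') hf hV
    (fun x hx h => hA x hx (.inr (.inr (.inr (.inl h)))))
    fun x hx h => hA x hx (.inr (.inr (.inr (.inr h))))]
  exact .trans cfg_drop_right (cfg_omit_of_subset Finset.subset_union_left)

/-! ### Entailment commutes with transitions -/

theorem Rule.IsVariant.rename {r₀ r : Rule L C} (h : r₀.IsVariant r) (hf : f.Injective) :
    r₀.IsVariant (r.rename f) := by
  obtain ⟨g, hg, rfl⟩ := h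
  refine ⟨f ∘ g, hf.comp_injOn hg, ?_⟩
  have hu : ∀ U : UserC L C, UserC.subst (renameVar f) (UserC.subst (renameVar g) U) =
      UserC.subst (renameVar (f ∘ g)) U := by
    intro U
    induction U with
    | top => rfl
    | atom a => exact congrArg Conj.atom (UserAtom.subst_subst _ _ a)
    | and U U' ih ih' => exact congrArg₂ Conj.and ih ih'
  have hb : ∀ B : BuiltinC L, BuiltinC.subst (renameVar f) (BuiltinC.subst (renameVar g) B) =
      BuiltinC.subst (renameVar (f ∘ g)) B := by
    intro B
    induction B with
    | top => rfl
    | atom a => exact congrArg Conj.atom (BuiltinAtom.subst_subst _ _ a)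
    | and U U' ih ih' => exact congrArg₂ Conj.and ih ih'
  simp [Rule.rename, hu, hb]

theorem Rule.mem_headVars {r : Rule L C} {x : ℕ} :
    x ∈ r.headVars ↔ x ∈ uvars r.kept.atoms ∨ x ∈ uvars r.removed.atoms := by
  simp [Rule.headVars, UserC.mem_vars]

theorem Rule.mem_locals {r : Rule L C} {x : ℕ} :
    x ∈ r.locals ↔ (x ∈ uvars r.bodyU.atoms ∨ x ∈ bvars r.bodyB.atoms ∨ x ∈ bvars r.guard.atoms) ∧
      x ∉ r.headVars := by
  simp [Rule.locals, Rule.bodyVars, UserC.mem_vars, BuiltinC.mem_vars]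

theorem Rule.mem_locals_rename {r : Rule L C} (hf : f.Injective) {y : ℕ} :
    y ∈ (r.rename f).locals ↔ ∃ x ∈ r.locals, f x = y := by
  simp only [Rule.mem_locals, Rule.mem_headVars, Rule.rename, UserC.subst, BuiltinC.subst,
    Conj.atoms_map, mem_uvars_rename, mem_bvars_rename]
  constructor
  · rintro ⟨⟨x, hx, rfl⟩ | ⟨x, hx, rfl⟩ | ⟨x, hx, rfl⟩, h⟩ <;>
      exact ⟨x, ⟨by tauto, fun h' => h (h'.imp (fun h => ⟨x, h, rfl⟩) fun h => ⟨x, h, rfl⟩)⟩, rfl⟩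
  · rintro ⟨x, ⟨h, h'⟩, rfl⟩
    refine ⟨h.imp (fun h => ⟨x, h, rfl⟩) (.imp (fun h => ⟨x, h, rfl⟩) fun h => ⟨x, h, rfl⟩), ?_⟩
    rintro (⟨z, hz, h⟩ | ⟨z, hz, h⟩) <;> rw [hf h] at hz <;> tauto

/-- A transition of an entailed state can be imitated by the entailing one, unless the latter is
failed and hence entails every state. -/
theorem StateEntails.exists_step {P : Program L C} (hCT : CT.IsComplete) {X Y Z : StateClass C CT}
    (h : StateEntails CT X Y) (hs : Step P CT Y Z) :
    ∃ X', Relation.ReflTransGen (Step P CT) X X' ∧ StateEntails CT X' Z := by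
  obtain ⟨r₀, r, U, B, V', hr₀, hr, hd, -⟩ := hs
  obtain ⟨S, rfl⟩ := Quotient.exists_rep X
  change StateEntails CT (S.cls CT) _ at h
  change ∃ X', Relation.ReflTransGen (Step P CT) (S.cls CT) X' ∧ _
  rw [cls_eq_cfg] at h ⊢
  rw [cls_normal] at h ⊢
  obtain ⟨g, -, hg⟩ := exists_cfg_eq_union CT (Goal.users S.store) (Goal.builtins S.store) S.glob V'
  rw [hg] at h ⊢
  generalize (Goal.users S.store).map (UserAtom.subst (renameVar g)) = u at *
  generalize (Goal.builtins S.store).map (BuiltinAtom.subst (renameVar g)) = b at *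
  clear hg
  by_cases hF : Failed CT b
  · exact ⟨_, .refl, cfg_failed_entails hF _⟩
  simp only [Conj.atoms] at h ⊢
  set V := V' ∪ S.glob
  have hV' : V' ⊆ V := Finset.subset_union_left
  obtain ⟨f, hf, hV, hA⟩ := exists_renaming V'
    ((uvars_finite u).union ((bvars_finite b).union (V.finite_toSet.union
      ((uvars_finite (r.kept.atoms + (r.bodyU.atoms + U.atoms))).union
        (bvars_finite (r.guard.atoms + (r.bodyB.atoms + B.atoms)))))))
  have hA' : ∀ x ∉ V', f x ∉ uvars u ∧ f x ∉ bvars b ∧ f x ∉ V := fun x hx =>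
    ⟨fun h => hA x hx (.inl h), fun h => hA x hx (.inr (.inl h)),
      fun h => hA x hx (.inr (.inr (.inl h)))⟩
  obtain ⟨e, he, hE⟩ := (cfg_refines h).exists_cfg_eq hF hV' hf hV hA'
  rw [hE]
  rw [Finset.disjoint_left] at hd
  have hloc : ∀ x ∈ (r.rename f).locals,
      x ∉ uvars (U.atoms.map (UserAtom.subst (renameVar f))) ∧
      x ∉ bvars (B.atoms.map (BuiltinAtom.subst (renameVar f)) + e) ∧ x ∉ V := by
    intro y hy
    obtain ⟨x, hx, rfl⟩ := (Rule.mem_locals_rename hf).1 hy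
    have hd := hd hx
    simp only [Finset.mem_union, not_or, UserC.mem_vars, BuiltinC.mem_vars] at hd
    obtain ⟨h₁, h₂, h₃⟩ := hA' x hd.2
    have key : ∀ {w : Multiset (UserAtom L C)}, x ∉ uvars w →
        f x ∉ uvars (w.map (UserAtom.subst (renameVar f))) := by
      intro w hw h
      obtain ⟨y, hy, h⟩ := mem_uvars_rename.1 h
      exact hw (hf h ▸ hy)
    refine ⟨key hd.1.1.2, ?_, h₃⟩
    rw [bvars_add]
    rintro (h | h)
    · obtain ⟨y, hy, h⟩ := mem_bvars_rename.1 h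
      exact hd.1.2 (hf h ▸ hy)
    · rcases he h with (h | h) | h
      · exact h₁ h
      · exact h₂ h
      · refine key ?_ h
        simp only [uvars_add, Set.mem_union]
        tauto
  simp only [Multiset.map_add, add_assoc] at hE ⊢
  by_cases hF' : Failed CT (r.guard.atoms.map (BuiltinAtom.subst (renameVar f)) +
      (B.atoms.map (BuiltinAtom.subst (renameVar f)) + e))
  · exact ⟨_, .refl, cfg_failed_entails hF' _⟩
  have hstep := cfg_step (P := P) (CT := CT) (r := r.rename f) hr₀ (hr.rename hf) hloc hCT
    (by simpa [Rule.rename, BuiltinC.subst] using hF')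
  simp only [Rule.rename, BuiltinC.subst, UserC.subst, Conj.atoms_map] at hstep
  refine ⟨_, .single hstep, ?_⟩
  rw [← cfg_rename hf hV
    (fun x hx h => hA x hx (.inr (.inr (.inr (.inl h)))))
    fun x hx h => hA x hx (.inr (.inr (.inr (.inr h))))]
  simp only [Multiset.map_add, ← add_assoc]
  exact .trans cfg_drop_right (cfg_omit_of_subset hV')

/-- Mixed sequences of transitions and entailments can be sorted. -/
theorem exists_steps_entails {P : Program L C} (hCT : CT.IsComplete) {X Y : StateClass C CT}
    (h : Relation.ReflTransGen (fun X Y => Step P CT X Y ∨ StateEntails CT X Y) X Y) :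
    ∃ X', Relation.ReflTransGen (Step P CT) X X' ∧ StateEntails CT X' Y := by
  induction h with
  | refl => exact ⟨X, .refl, .refl X⟩
  | tail _ h ih =>
    obtain ⟨X', hX', hent⟩ := ih
    rcases h with h | h
    · obtain ⟨X'', hX'', h⟩ := hent.exists_step hCT h
      exact ⟨X'', hX'.trans hX'', h⟩
    · exact ⟨X', hX', hent.trans h⟩

end Rename

/-! ### Phase semantics -/

section Phase

open scoped Pointwise

variable {M : Type*} [AddCommMonoid M] {Q X Y F G : Set M}

/-- Orthogonality with respect to the pole `Q`. -/
def perp (Q X : Set M) : Set M := {m | ∀ x ∈ X, m + x ∈ Q}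

/-- Biorthogonal closure. -/
def cl (Q X : Set M) : Set M := perp Q (perp Q X)

/-- Facts are the sets closed under biorthogonality. -/
def IsFact (Q X : Set M) : Prop := cl Q X ⊆ X

theorem perp_anti (h : X ⊆ Y) : perp Q Y ⊆ perp Q X := fun _ hm x hx => hm x (h hx)

theorem subset_cl : X ⊆ cl Q X := fun x hx k hk => add_comm k x ▸ hk x hx

theorem cl_mono (h : X ⊆ Y) : cl Q X ⊆ cl Q Y := perp_anti (perp_anti h)

theorem isFact_cl : IsFact Q (cl Q X) := perp_anti subset_cl

theorem IsFact.cl_subset (hF : IsFact Q F) (h : X ⊆ F) : cl Q X ⊆ F := (cl_mono h).trans hF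

theorem isFact_pole : IsFact Q Q := fun m hm => by
  simpa using hm 0 fun x hx => by simpa using hx

theorem IsFact.cl_add_subset (hF : IsFact Q F) (h : X + Y ⊆ F) : cl Q X + Y ⊆ F := by
  rintro _ ⟨m, hm, y, hy, rfl⟩
  refine hF fun k hk => ?_
  rw [add_assoc]
  refine hm _ fun x hx => ?_
  rw [add_comm (y + k) x, ← add_assoc, add_comm]
  exact hk _ (h ⟨x, hx, y, hy, rfl⟩)

theorem cl_add_cl : cl Q X + cl Q Y ⊆ cl Q (X + Y) := by
  refine isFact_cl.cl_add_subset ?_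
  rw [add_comm]
  refine isFact_cl.cl_add_subset ?_
  rw [add_comm]
  exact subset_cl

theorem cl_cl_add_cl : cl Q (cl Q X + cl Q Y) = cl Q (X + Y) :=
  (isFact_cl.cl_subset cl_add_cl).antisymm (cl_mono (Set.add_subset_add subset_cl subset_cl))

theorem cl_iUnion_cl {ι : Sort*} (X : ι → Set M) : cl Q (⋃ i, cl Q (X i)) = cl Q (⋃ i, X i) :=
  (isFact_cl.cl_subset (Set.iUnion_subset fun i => cl_mono (Set.subset_iUnion X i))).antisymm
    (cl_mono (Set.iUnion_mono fun _ => subset_cl))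

theorem sum_cl_subset {ι : Type*} (s : Multiset ι) (X : ι → Set M) :
    (s.map fun i => cl Q (X i)).sum ⊆ cl Q (s.map X).sum := by
  induction s using Multiset.induction_on with
  | empty => exact subset_cl (X := (0 : Set M))
  | cons i s ih =>
    simp only [Multiset.map_cons, Multiset.sum_cons]
    exact (Set.add_subset_add subset_rfl ih).trans cl_add_cl

/-- The elements that may be weakened and contracted. -/
def exponentials (Q : Set M) : AddSubmonoid M where
  carrier := {m | m ∈ cl Q {0} ∧ m ∈ cl Q {m + m}}
  zero_mem' := ⟨subset_cl rfl, subset_cl (by simp)⟩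
  add_mem' := by
    rintro m n ⟨hm, hm'⟩ ⟨hn, hn'⟩
    constructor
    · have := cl_add_cl (Q := Q) (X := {0}) (Y := {0}) ⟨m, hm, n, hn, rfl⟩
      simpa using this
    · have := cl_add_cl (Q := Q) (X := {m + m}) (Y := {n + n}) ⟨m, hm', n, hn', rfl⟩
      rw [Set.singleton_add_singleton] at this
      rwa [add_add_add_comm m n m n]

theorem sum_inter_exponentials {ι : Type*} (s : Multiset ι) (X : ι → Set M) :
    (s.map fun i => X i ∩ exponentials Q).sum ⊆ exponentials Q := by
  induction s using Multiset.induction_on with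
  | empty =>
    intro x hx
    have : x = 0 := by simpa using hx
    exact this ▸ (exponentials Q).zero_mem
  | cons i s ih =>
    simp only [Multiset.map_cons, Multiset.sum_cons]
    rintro _ ⟨x, hx, y, hy, rfl⟩
    exact (exponentials Q).add_mem hx.2 (ih hy)

theorem sum_mono {ι : Type*} (s : Multiset ι) {X Y : ι → Set M} (h : ∀ i, X i ⊆ Y i) :
    (s.map X).sum ⊆ (s.map Y).sum := by
  induction s using Multiset.induction_on with
  | empty => simp
  | cons i s ih =>
    simp only [Multiset.map_cons, Multiset.sum_cons]
    exact Set.add_subset_add (h i) ih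

end Phase

/-! ### The phase model of goals -/

/-- The monoid of goals up to equivalence, as pairs of a user-defined and a built-in part. -/
abbrev Store (L : FirstOrder.Language.{u, u}) (C : ℕ → Type u) : Type u :=
  Multiset (UserAtom L C) × Multiset (BuiltinAtom L)

/-- A valuation extended by a value for the last bound variable. -/
def extend {n : ℕ} (e : ℕ ⊕ Fin n → L.Term ℕ) (t : L.Term ℕ) : ℕ ⊕ Fin (n + 1) → L.Term ℕ :=
  Sum.elim (fun x => e (.inl x)) (Fin.lastCases t fun i => e (.inr i))

/-- A valuation of the free variables alone. -/
def free (e : ℕ → L.Term ℕ) : ℕ ⊕ Fin 0 → L.Term ℕ := Sum.elim e Fin.elim0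

section Interp

open scoped Pointwise

/-- The phase model with pole `Q`: variables range over terms, and an atom denotes the closure of
itself. -/
def interp (Q : Set (Store L C)) :
    {n : ℕ} → LForm L C n → (ℕ ⊕ Fin n → L.Term ℕ) → Set (Store L C)
  | _, .user c ts, e => cl Q {({.mk c fun i => (ts i).subst e}, 0)}
  | _, .eq s t, e => cl Q {(0, {.eq (s.subst e) (t.subst e)})}
  | _, .rel R ts, e => cl Q {(0, {.rel R fun i => (ts i).subst e})}
  | _, .one, _ => cl Q {0}
  | _, .zero, _ => cl Q ∅
  | _, .top, _ => Set.univ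
  | _, .tensor α β, e => cl Q (interp Q α e + interp Q β e)
  | _, .lolli α β, e => {m | ∀ x ∈ interp Q α e, m + x ∈ interp Q β e}
  | _, .amp α β, e => interp Q α e ∩ interp Q β e
  | _, .plus α β, e => cl Q (interp Q α e ∪ interp Q β e)
  | _, .bang α, e => cl Q (interp Q α e ∩ exponentials Q)
  | _, .ex α, e => cl Q (⋃ t, interp Q α (extend e t))
  | _, .all α, e => ⋂ t, interp Q α (extend e t)

variable {Q : Set (Store L C)}

theorem isFact_interp {n : ℕ} (α : LForm L C n) (e : ℕ ⊕ Fin n → L.Term ℕ) :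
    IsFact Q (interp Q α e) := by
  induction α with
  | top => exact Set.subset_univ _
  | lolli α β _ ih =>
    intro m hm x hx
    refine (ih e).cl_add_subset (X := {m | ∀ x ∈ interp Q α e, m + x ∈ interp Q β e})
      (Y := interp Q α e) ?_ ⟨m, hm, x, hx, rfl⟩
    rintro _ ⟨m, hm, x, hx, rfl⟩
    exact hm x hx
  | amp α β ih ih' =>
    exact Set.subset_inter ((ih e).cl_subset Set.inter_subset_left)
      ((ih' e).cl_subset Set.inter_subset_right)
  | all α ih =>
    exact Set.subset_iInter fun t => (ih _).cl_subset (Set.iInter_subset _ t)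
  | _ => exact isFact_cl

theorem term_relabel_subst {α β γ : Type*} (g : α → β) (σ : β → L.Term γ) (t : L.Term α) :
    (t.relabel g).subst σ = t.subst (σ ∘ g) := by
  induction t with
  | var x => rfl
  | func f ts ih => simp [Term.relabel, Term.subst, ih]

theorem extend_last {n : ℕ} (e : ℕ ⊕ Fin n → L.Term ℕ) (t : L.Term ℕ) :
    extend e t (.inr (Fin.last n)) = t := by
  simp [extend]

theorem extend_comp_castSucc {n : ℕ} (e : ℕ ⊕ Fin n → L.Term ℕ) (t : L.Term ℕ) :
    extend e t ∘ Sum.map id Fin.castSucc = e := by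
  funext x
  cases x <;> simp [extend]

theorem lift_subst_extend {n m : ℕ} (σ : ℕ ⊕ Fin n → L.Term (ℕ ⊕ Fin m))
    (e : ℕ ⊕ Fin m → L.Term ℕ) (t : L.Term ℕ) :
    (fun x => (LForm.lift σ x).subst (extend e t)) = extend (fun x => (σ x).subst e) t := by
  funext x
  rcases x with x | i
  · simp only [LForm.lift, Sum.elim_inl, term_relabel_subst, extend_comp_castSucc]
    simp [extend]
  · refine Fin.lastCases ?_ (fun i => ?_) i
    · simp [LForm.lift, extend, Term.subst]
    · simp only [LForm.lift, Sum.elim_inr, Fin.lastCases_castSucc, term_relabel_subst,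
        extend_comp_castSucc]
      simp [extend]

theorem interp_subst {n m : ℕ} (α : LForm L C n) (σ : ℕ ⊕ Fin n → L.Term (ℕ ⊕ Fin m))
    (e : ℕ ⊕ Fin m → L.Term ℕ) :
    interp Q (α.subst σ) e = interp Q α fun x => (σ x).subst e := by
  induction α generalizing m with
  | user | eq | rel => simp [LForm.subst, interp, term_subst_subst]
  | one | zero | top => rfl
  | tensor _ _ ih ih' | lolli _ _ ih ih' | amp _ _ ih ih' | plus _ _ ih ih' =>
    simp only [LForm.subst, interp, ih, ih']
  | bang _ ih => simp only [LForm.subst, interp, ih]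
  | ex _ ih | all _ ih => simp only [LForm.subst, interp, ih, lift_subst_extend]

theorem term_subst_congr_left {n : ℕ} {e e' : ℕ ⊕ Fin n → L.Term ℕ} {t : L.Term (ℕ ⊕ Fin n)}
    (h : ∀ x ∈ t.varFinsetLeft, e (.inl x) = e' (.inl x)) (h' : ∀ i, e (.inr i) = e' (.inr i)) :
    t.subst e = t.subst e' := by
  induction t with
  | var x =>
    rcases x with x | i
    · exact h x (by simp [Term.varFinsetLeft])
    · exact h' i
  | func f ts ih =>
    simp only [Term.subst]
    congr 1
    funext i
    exact ih i fun x hx => h x (by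
      simp only [Term.varFinsetLeft, Finset.mem_biUnion, Finset.mem_univ, true_and]
      exact ⟨i, hx⟩)

theorem interp_congr {n : ℕ} {α : LForm L C n} {e e' : ℕ ⊕ Fin n → L.Term ℕ}
    (h : ∀ x ∈ α.freeVars, e (.inl x) = e' (.inl x)) (h' : ∀ i, e (.inr i) = e' (.inr i)) :
    interp Q α e = interp Q α e' := by
  have hext : ∀ {n : ℕ} {e e' : ℕ ⊕ Fin n → L.Term ℕ} (_ : ∀ i, e (.inr i) = e' (.inr i))
      (t : L.Term ℕ) (i : Fin (n + 1)), extend e t (.inr i) = extend e' t (.inr i) := by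
    intro n e e' h t i
    refine Fin.lastCases ?_ (fun i => ?_) i <;> simp [extend, h]
  induction α with
  | user c ts =>
    have : (fun i => (ts i).subst e) = fun i => (ts i).subst e' := funext fun i =>
      term_subst_congr_left (fun x hx => h x (by
        simp only [LForm.freeVars, Finset.mem_biUnion, Finset.mem_univ, true_and]
        exact ⟨i, hx⟩)) h'
    simp only [interp, this]
  | rel c ts =>
    have : (fun i => (ts i).subst e) = fun i => (ts i).subst e' := funext fun i =>
      term_subst_congr_left (fun x hx => h x (by
        simp only [LForm.freeVars, Finset.mem_biUnion, Finset.mem_univ, true_and]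
        exact ⟨i, hx⟩)) h'
    simp only [interp, this]
  | eq s t =>
    simp only [interp]
    rw [term_subst_congr_left (t := s) (fun x hx => h x (by simp [LForm.freeVars, hx])) h',
      term_subst_congr_left (t := t) (fun x hx => h x (by simp [LForm.freeVars, hx])) h']
  | one | zero | top => rfl
  | tensor _ _ ih ih' | lolli _ _ ih ih' | amp _ _ ih ih' | plus _ _ ih ih' =>
    simp only [interp]
    rw [ih (fun x hx => h x (by simp [LForm.freeVars, hx])) h',
      ih' (fun x hx => h x (by simp [LForm.freeVars, hx])) h']
  | bang _ ih =>
    simp only [interp]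
    rw [ih (fun x hx => h x hx) h']
  | ex _ ih | all _ ih =>
    simp only [interp]
    have := fun t => ih (fun x hx => h x hx) (hext h' t)
    simp only [this]

theorem interp_inst (α : LForm L C 1) (t : L.Term ℕ) (e : ℕ → L.Term ℕ) :
    interp Q (.inst t α) (free e) = interp Q α (extend (free e) (t.subst e)) := by
  rw [LForm.inst, interp_subst]
  congr 1
  funext x
  rcases x with x | i
  · rfl
  · rw [Subsingleton.elim i (Fin.last 0)]
    simp only [Sum.elim_inr, extend, Fin.lastCases_last, term_relabel_subst]
    rfl

theorem interp_exVar (x : ℕ) (α : LForm L C 0) (e : ℕ → L.Term ℕ) :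
    interp Q (.exVar x α) (free e) = cl Q (⋃ t, interp Q α (free (Function.update e x t))) := by
  simp only [LForm.exVar, interp, interp_subst]
  congr! 4 with t
  funext y
  rcases y with y | i
  · by_cases h : y = x
    · subst h
      simp only [Sum.elim_inl, if_true, Term.subst, free, Function.update_self]
      exact extend_last _ _
    · simp [h, free, extend, Term.subst]
  · exact i.elim0

theorem interp_exs (s : Finset ℕ) (α : LForm L C 0) (e : ℕ → L.Term ℕ) :
    interp Q (.exs s α) (free e) =
      cl Q (⋃ e' : {e' : ℕ → L.Term ℕ // ∀ x ∉ s, e' x = e x}, interp Q α (free e')) := by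
  have key : ∀ (l : List ℕ) (e : ℕ → L.Term ℕ), interp Q (l.foldr LForm.exVar α) (free e) =
      cl Q (⋃ e' : {e' : ℕ → L.Term ℕ // ∀ x ∉ l, e' x = e x}, interp Q α (free e')) := by
    intro l
    induction l with
    | nil =>
      intro e
      refine (subset_cl.trans (cl_mono ?_)).antisymm
        ((isFact_interp α _).cl_subset (Set.iUnion_subset ?_))
      · exact Set.subset_iUnion_of_subset ⟨e, fun _ _ => rfl⟩ subset_rfl
      · rintro ⟨e', he'⟩
        obtain rfl : e' = e := funext fun x => he' x (by simp)
        exact subset_rfl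
    | cons x l ih =>
      intro e
      rw [List.foldr_cons, interp_exVar]
      simp only [ih]
      rw [cl_iUnion_cl]
      congr 1
      apply subset_antisymm
      · refine Set.iUnion_subset fun t => Set.iUnion_subset fun ⟨e', he'⟩ => ?_
        refine Set.subset_iUnion_of_subset ⟨e', fun y hy => ?_⟩ subset_rfl
        rw [List.mem_cons, not_or] at hy
        rw [he' y hy.2, Function.update_of_ne hy.1]
      · refine Set.iUnion_subset fun ⟨e', he'⟩ => ?_
        refine Set.subset_iUnion_of_subset (e' x) (Set.subset_iUnion_of_subset
          ⟨e', fun y hy => ?_⟩ subset_rfl)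
        by_cases h : y = x
        · subst h; simp
        · rw [Function.update_of_ne h, he' y (by simp [h, hy])]
  refine (key (s.sort (· ≤ ·)) e).trans (congrArg _ ?_)
  ext m
  simp only [Set.mem_iUnion, Subtype.exists, Finset.mem_sort]

/-- Validity of a sequent in the phase model. -/
def Sound (Q : Set (Store L C)) (Γ : Multiset (LForm L C 0)) (α : LForm L C 0) : Prop :=
  ∀ e : ℕ → L.Term ℕ, (Γ.map fun γ => interp Q γ (free e)).sum ⊆ interp Q α (free e)

theorem sum_congr_update {Γ : Multiset (LForm L C 0)} {a : ℕ} (h : ∀ γ ∈ Γ, a ∉ γ.freeVars)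
    (e : ℕ → L.Term ℕ) (t : L.Term ℕ) :
    (Γ.map fun γ => interp Q γ (free (Function.update e a t))) =
      Γ.map fun γ => interp Q γ (free e) := by
  refine Multiset.map_congr rfl fun γ hγ => interp_congr (fun x hx => ?_) fun i => i.elim0
  refine Function.update_of_ne ?_ _ _
  rintro rfl
  exact h γ hγ hx

theorem interp_inst_update {α : LForm L C 1} {a : ℕ} (h : a ∉ α.freeVars) (e : ℕ → L.Term ℕ)
    (t : L.Term ℕ) : interp Q (.inst (.var a) α) (free (Function.update e a t)) =
      interp Q α (extend (free e) t) := by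
  rw [interp_inst]
  refine interp_congr (fun x hx => ?_) fun i => ?_
  · refine Function.update_of_ne ?_ _ _
    rintro rfl
    exact h hx
  · rw [Subsingleton.elim i (Fin.last 0)]
    rw [extend_last, extend_last]
    simp [Term.subst]

/-- Soundness of the sequent calculus for phase models that validate the proper axioms. -/
theorem Provable.sound {Ax : Set (Sequent L C)} (hAx : ∀ Γ α, (Γ, α) ∈ Ax → Sound Q Γ α)
    {Γ : Multiset (LForm L C 0)} {α : LForm L C 0} (h : Provable Ax Γ α) : Sound Q Γ α := by
  induction h with
  | proper h => exact hAx _ _ h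
  | identity α => intro e; simp
  | cut _ _ ih ih' =>
    intro e
    have h := ih e
    have h' := ih' e
    simp only [Multiset.map_cons, Multiset.sum_cons, Multiset.map_add, Multiset.sum_add] at h' ⊢
    exact (Set.add_subset_add h subset_rfl).trans h'
  | tensorL _ ih =>
    intro e
    have h := ih e
    simp only [Multiset.map_cons, Multiset.sum_cons, ← add_assoc] at h ⊢
    exact (isFact_interp _ _).cl_add_subset h
  | tensorR _ _ ih ih' =>
    intro e
    simp only [Multiset.map_add, Multiset.sum_add]
    exact (Set.add_subset_add (ih e) (ih' e)).trans subset_cl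
  | oneL _ ih =>
    intro e
    simp only [Multiset.map_cons, Multiset.sum_cons]
    refine (isFact_interp _ _).cl_add_subset ?_
    simpa using ih e
  | oneR =>
    intro e
    simpa [interp] using subset_cl (Q := Q) (X := {0})
  | lolliL _ _ ih ih' =>
    intro e
    have h := ih e
    have h' := ih' e
    simp only [Multiset.map_cons, Multiset.sum_cons, Multiset.map_add, Multiset.sum_add] at h' ⊢
    rw [← add_assoc]
    refine (Set.add_subset_add ?_ subset_rfl).trans h'
    rintro _ ⟨m, hm, x, hx, rfl⟩
    exact hm x (h hx)
  | lolliR _ ih =>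
    intro e m hm x hx
    have h := ih e
    simp only [Multiset.map_cons, Multiset.sum_cons] at h
    exact h ⟨x, hx, m, hm, add_comm x m⟩
  | @bangR Γ α _ ih =>
    intro e
    have h := ih e
    simp only [Multiset.map_map, Function.comp_def, interp] at h ⊢
    refine (sum_cl_subset _ _).trans (cl_mono (Set.subset_inter ?_ (sum_inter_exponentials _ _)))
    exact (sum_mono _ fun _ => subset_cl).trans h
  | dereliction _ ih =>
    intro e
    have h := ih e
    simp only [Multiset.map_cons, Multiset.sum_cons] at h ⊢
    refine (isFact_interp _ _).cl_add_subset ?_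
    exact (Set.add_subset_add Set.inter_subset_left subset_rfl).trans h
  | contraction _ ih =>
    intro e
    have h := ih e
    simp only [Multiset.map_cons, Multiset.sum_cons] at h ⊢
    refine (isFact_interp _ _).cl_add_subset ?_
    rintro _ ⟨x, hx, y, hy, rfl⟩
    refine (isFact_interp _ _).cl_add_subset (X := {x + x}) (Y := {y}) ?_
      ⟨x, hx.2.2, y, rfl, rfl⟩
    rw [Set.singleton_add_singleton, Set.singleton_subset_iff, add_assoc]
    exact h ⟨x, subset_cl hx, x + y, ⟨x, subset_cl hx, y, hy, rfl⟩, rfl⟩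
  | weakening _ ih =>
    intro e
    simp only [Multiset.map_cons, Multiset.sum_cons]
    refine (isFact_interp _ _).cl_add_subset ?_
    rintro _ ⟨x, hx, y, hy, rfl⟩
    refine (isFact_interp _ _).cl_add_subset (X := {0}) (Y := {y}) ?_ ⟨x, hx.2.1, y, rfl, rfl⟩
    rw [Set.singleton_add_singleton, Set.singleton_subset_iff, zero_add]
    exact ih e hy
  | ampL₁ _ ih =>
    intro e
    have h := ih e
    simp only [Multiset.map_cons, Multiset.sum_cons] at h ⊢
    exact (Set.add_subset_add Set.inter_subset_left subset_rfl).trans h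
  | ampL₂ _ ih =>
    intro e
    have h := ih e
    simp only [Multiset.map_cons, Multiset.sum_cons] at h ⊢
    exact (Set.add_subset_add Set.inter_subset_right subset_rfl).trans h
  | ampR _ _ ih ih' => exact fun e => Set.subset_inter (ih e) (ih' e)
  | topR Γ => exact fun e => Set.subset_univ _
  | plusL _ _ ih ih' =>
    intro e
    have h := ih e
    have h' := ih' e
    simp only [Multiset.map_cons, Multiset.sum_cons] at h h' ⊢
    refine (isFact_interp _ _).cl_add_subset ?_
    rw [Set.union_add]
    exact Set.union_subset h h'
  | plusR₁ _ ih => exact fun e => (ih e).trans (Set.subset_union_left.trans subset_cl)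
  | plusR₂ _ ih => exact fun e => (ih e).trans (Set.subset_union_right.trans subset_cl)
  | zeroL α =>
    intro e
    simpa [interp] using (isFact_interp (Q := Q) α (free e)).cl_subset (Set.empty_subset _)
  | allL t _ ih =>
    intro e
    have h := ih e
    simp only [Multiset.map_cons, Multiset.sum_cons, interp_inst] at h ⊢
    exact (Set.add_subset_add (Set.iInter_subset _ _) subset_rfl).trans h
  | allR a hΓ hβ _ ih =>
    intro e
    refine Set.subset_iInter fun t => ?_
    have h := ih (Function.update e a t)
    rwa [sum_congr_update hΓ, interp_inst_update hβ] at h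
  | @exL Γ α β a hΓ hα hβ _ ih =>
    intro e
    simp only [Multiset.map_cons, Multiset.sum_cons]
    refine (isFact_interp _ _).cl_add_subset ?_
    rw [Set.iUnion_add]
    refine Set.iUnion_subset fun t => ?_
    have h := ih (Function.update e a t)
    rw [Multiset.map_cons, Multiset.sum_cons, sum_congr_update hΓ, interp_inst_update hα] at h
    rwa [interp_congr (α := β) (e' := free e) (fun x hx => ?_) fun i => i.elim0] at h
    refine Function.update_of_ne ?_ _ _
    rintro rfl
    exact hβ hx
  | exR t _ ih =>
    intro e
    have h := ih e
    rw [interp_inst] at h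
    exact h.trans ((Set.subset_iUnion (fun t => interp Q _ (extend (free e) t)) _).trans subset_cl)

end Interp

/-! ### The pole of stores that reach a target state -/

section Pole

open scoped Pointwise

variable {P : Program L C} {CT : ConstraintTheory L} {V : Finset ℕ} {X : StateClass C CT}

/-- The stores from which, with global variables `V`, the class `X` is reachable by transitions and
entailments in any order. -/
def pole (P : Program L C) (CT : ConstraintTheory L) (V : Finset ℕ) (X : StateClass C CT) :
    Set (Store L C) :=
  {m | Relation.ReflTransGen (fun Y Z => Step P CT Y Z ∨ StateEntails CT Y Z) (cfg CT m.1 m.2 V) X}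

theorem mem_pole_of_entails {m : Store L C} (h : StateEntails CT (cfg CT m.1 m.2 V) X) :
    m ∈ pole P CT V X :=
  .single (.inr h)

theorem mem_pole_of_refines {m m' : Store L C} (h : Refines CT m.1 m.2 V m'.1 m'.2 V)
    (h' : m' ∈ pole P CT V X) : m ∈ pole P CT V X :=
  .head (.inr h.stateEntails) h'

theorem mem_pole_of_step {m m' : Store L C}
    (h : Step P CT (cfg CT m.1 m.2 V) (cfg CT m'.1 m'.2 V))
    (h' : m' ∈ pole P CT V X) : m ∈ pole P CT V X :=
  .head (.inl h) h'

/-- Refinement in every context makes a store a member of the closure of the other. -/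
theorem mem_cl_of_refines {m m' : Store L C}
    (h : ∀ k : Store L C, Refines CT (m + k).1 (m + k).2 V (m' + k).1 (m' + k).2 V) :
    m ∈ cl (pole P CT V X) {m'} := fun k hk =>
  mem_pole_of_refines (h k) (add_comm k m' ▸ hk m' rfl)

/-- Built-in atoms are themselves exponential, so that `!` does not change their denotation. -/
theorem builtin_mem_exponentials (b : BuiltinAtom L) :
    ((0, {b}) : Store L C) ∈ exponentials (pole P CT V X) := by
  refine ⟨mem_cl_of_refines fun k => ?_, mem_cl_of_refines fun k => ?_⟩
  · simp only [Prod.fst_add, Prod.snd_add, Prod.fst_zero, Prod.snd_zero]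
    exact .of_weaken fun p v hv => ⟨v, fun _ _ => rfl, by
      rw [sat_add] at hv; simpa using hv.2⟩
  · simp only [Prod.fst_add, Prod.snd_add, add_zero]
    exact .of_weaken fun p v hv => ⟨v, fun _ _ => rfl, by
      rw [sat_add] at hv; exact sat_add.2 ⟨sat_add.2 ⟨hv.1, hv.1⟩, hv.2⟩⟩

theorem cl_bang {M : Type*} [AddCommMonoid M] {Q : Set M} {m : M} (h : m ∈ exponentials Q) :
    cl Q (cl Q {m} ∩ exponentials Q) = cl Q {m} := by
  refine (isFact_cl.cl_subset Set.inter_subset_left).antisymm (cl_mono ?_)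
  rw [Set.singleton_subset_iff]
  exact ⟨subset_cl rfl, h⟩

theorem embed_subst (t : L.Term ℕ) (σ : ℕ → L.Term ℕ) :
    (embed t).subst (free σ) = t.subst σ := term_relabel_subst _ _ _

/-- An instance of a goal, as an element of the phase monoid. -/
def Goal.store (G : Goal L C) (σ : ℕ → L.Term ℕ) : Store L C :=
  ((Goal.users G).map (UserAtom.subst σ), (Goal.builtins G).map (BuiltinAtom.subst σ))

/-- A goal denotes the closure of itself.  For falsity, which is read as `0`, this holds because
failed states entail every state. -/
theorem interp_goal (G : Goal L C) (σ : ℕ → L.Term ℕ) :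
    interp (pole P CT V X) (Goal.toL G) (free σ) = cl (pole P CT V X) {Goal.store G σ} := by
  induction G with
  | top => rfl
  | atom a =>
    rcases a with ⟨c, ts⟩ | b
    · simp [Goal.toL, UserAtom.toL, interp, embed_subst, Goal.store, Goal.users, Goal.builtins,
        UserAtom.subst]
    · cases b with
      | bot =>
        simp only [Goal.toL, BuiltinAtom.toL, interp]
        refine (cl_mono (Set.empty_subset _)).antisymm (isFact_cl.cl_subset ?_)
        rw [Set.singleton_subset_iff]
        intro k _
        refine mem_pole_of_entails (cfg_failed_entails (fun p v hv => hv .bot ?_) _)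
        simp [Goal.store, Goal.builtins, BuiltinAtom.subst]
      | eq | rel =>
        simpa [Goal.toL, BuiltinAtom.toL, interp, embed_subst, Goal.store, Goal.users,
          Goal.builtins, BuiltinAtom.subst] using cl_bang (builtin_mem_exponentials _)
  | and G G' ih ih' =>
    simp only [Goal.toL, interp, ih, ih', cl_cl_add_cl, Set.singleton_add_singleton]
    simp [Goal.store, Goal.users, Goal.builtins]

/-! ### Validity of the proper axioms -/

theorem sound_singleton {Q : Set (Store L C)} {α β : LForm L C 0} :
    Sound Q {α} β ↔ ∀ e, interp Q α (free e) ⊆ interp Q β (free e) := by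
  simp [Sound]

theorem sound_goal {G : Goal L C} {β : LForm L C 0} :
    Sound (pole P CT V X) {Goal.toL G} β ↔
      ∀ e, Goal.store G e ∈ interp (pole P CT V X) β (free e) := by
  simp only [sound_singleton, interp_goal]
  refine forall_congr' fun e => ⟨fun h => h (subset_cl rfl), fun h => ?_⟩
  exact (isFact_interp β _).cl_subset (Set.singleton_subset_iff.2 h)

theorem sound_sigmaCT {Γ : Multiset (LForm L C 0)} {α : LForm L C 0}
    (h : (Γ, α) ∈ sigmaCT C CT) : Sound (pole P CT V X) Γ α := by
  obtain ⟨s, B, s', B', hm, h⟩ := h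
  obtain ⟨rfl, rfl⟩ := Prod.mk.inj h
  rw [sound_singleton]
  intro e
  rw [interp_exs]
  refine (isFact_interp _ _).cl_subset (Set.iUnion_subset fun ⟨e', he'⟩ => ?_)
  simp only [BuiltinC.toL, interp_exs, interp_goal, cl_iUnion_cl]
  refine isFact_cl.cl_subset (Set.singleton_subset_iff.2 fun k hk => ?_)
  simp only [perp, Set.mem_iUnion, Set.mem_singleton_iff] at hk
  -- The quantified variables are instantiated by variables that are fresh for the context.
  obtain ⟨N, hN⟩ := exists_bound <| (uvars_finite k.1).union <| (bvars_finite k.2).union <|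
    V.finite_toSet.union <| bvars_finite (B'.atoms.map (BuiltinAtom.subst e))
  let τ : ℕ → L.Term ℕ := fun x => if x ∈ s' then .var (x + N) else e x
  have hτ := hk (Goal.store B'.toGoal τ) ⟨⟨τ, fun x hx => if_neg hx⟩, rfl⟩
  rw [add_comm] at hτ
  refine mem_pole_of_refines ?_ hτ
  simp only [Goal.store, Goal.users_builtin_toGoal, Goal.builtins_builtin_toGoal,
    Prod.fst_add, Prod.snd_add, Multiset.map_zero]
  refine .of_weaken fun p v hv => ?_
  rw [sat_add, sat_subst] at hv
  obtain ⟨w, hw, hw'⟩ := models_geomImp.1 hm p (fun x => (e x).realize v)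
    (fun x => (e' x).realize v) (fun x hx => by rw [he' x hx]) hv.1
  have hlt : ∀ {x}, x < N → (if x < N then v x else w (x - N)) = v x := fun h => if_pos h
  refine ⟨fun x => if x < N then v x else w (x - N), fun x hx => hlt (hN x ?_), ?_⟩
  · rw [zero_add] at hx
    exact hx.imp id fun h => .inr (.inl h)
  · rw [sat_add, sat_subst]
    refine ⟨(sat_congr fun x hx => ?_).1 hw', (sat_congr fun x hx => ?_).1 hv.2⟩
    · by_cases h : x ∈ s'
      · simp [τ, h]
      · rw [hw x h]
        simp only [τ, if_neg h]
        refine realize_congr fun y hy => (hlt (hN y ?_)).symm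
        exact .inr (.inr (.inr (mem_bvars_map_subst.2 ⟨x, hx, hy⟩)))
    · exact (hlt (hN x (.inr (.inl hx)))).symm

theorem sound_sigmaEq {Γ : Multiset (LForm L C 0)} {α : LForm L C 0}
    (h : (Γ, α) ∈ sigmaEq L C) : Sound (pole P CT V X) Γ α := by
  obtain ⟨n, c, ts, j, t, h⟩ := h
  obtain ⟨rfl, rfl⟩ := Prod.mk.inj h
  change Sound _ {Goal.toL (.and (.atom (.inl (.mk c ts))) (.atom (.inr (.eq (ts j) t))))}
    (Goal.toL (.and (.atom (.inl (.mk c (Function.update ts j t)))) (.atom (.inr (.eq (ts j) t)))))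
  rw [sound_goal]
  intro e
  rw [interp_goal]
  refine mem_cl_of_refines fun k => ?_
  simp only [Goal.store, Goal.users, Goal.builtins, Prod.fst_add, Prod.snd_add, add_zero, zero_add,
    Multiset.map_singleton, Multiset.singleton_add]
  refine ⟨fun a a' => (a = (UserAtom.mk c ts).subst e ∧
    a' = (UserAtom.mk c (Function.update ts j t)).subst e) ∨ a = a',
    .inl (.cons (.inl ⟨rfl, rfl⟩) (Multiset.rel_refl_of_refl_on fun _ _ => .inr rfl)), ?_⟩
  intro p v ρ hv hρ
  refine ⟨v, hv, fun x hx => (hρ x hx).symm, ?_⟩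
  have hv := (sat_cons.1 hv).1
  simp only [BuiltinAtom.subst, BuiltinAtom.Holds] at hv
  rintro a a' (⟨rfl, rfl⟩ | rfl)
  · refine ⟨c, _, _, fun i => ?_⟩
    by_cases h : i = j
    · subst h; simpa using hv
    · rw [Function.update_of_ne h]
  · exact .of_eqOn fun _ _ => rfl

/-- A rule axiom is valid because the rule can be applied with fresh variables: the given
instance of head and guard refines a fresh variant of them, together with the equations that identify
the variables of the fresh head with the terms of the instance.  The local variables of the guard need
no equations: their instance on the left of the axiom is a witness for the fresh ones. -/
theorem sound_sigmaP (hCT : CT.IsComplete) {Γ : Multiset (LForm L C 0)} {α : LForm L C 0}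
    (h : (Γ, α) ∈ sigmaP P) : Sound (pole P CT V X) Γ α := by
  obtain ⟨r₀, hr₀, r, hr, h⟩ := h
  obtain ⟨rfl, rfl⟩ := Prod.mk.inj h
  change Sound _ {Goal.toL (.and r.kept.toGoal (.and r.removed.toGoal r.guard.toGoal))}
    (.tensor (Goal.toL r.kept.toGoal) (.exs r.locals
      (Goal.toL (.and r.bodyB.toGoal (.and r.bodyU.toGoal r.guard.toGoal)))))
  rw [sound_goal]
  intro e
  simp only [interp, interp_exs, interp_goal, cl_iUnion_cl, cl_cl_add_cl]
  intro k hk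
  obtain ⟨f, hf, -, hA⟩ := exists_renaming ∅ <|
    (uvars_finite ((r.kept.atoms + r.removed.atoms).map (UserAtom.subst e))).union <|
      (uvars_finite k.1).union <| (bvars_finite k.2).union V.finite_toSet
  have hA : ∀ y, y ∈ uvars ((r.kept.atoms + r.removed.atoms).map (UserAtom.subst e)) ∨
      y ∈ uvars k.1 ∨ y ∈ bvars k.2 ∨ y ∈ V → ∀ x, f x ≠ y := by
    rintro _ h x rfl
    exact hA x (by simp) h
  let τ : ℕ → L.Term ℕ := fun x => if x ∈ r.locals then .var (f x) else e x
  have hτ := hk _ ⟨Goal.store r.kept.toGoal e, rfl, Goal.store _ τ,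
    Set.mem_iUnion.2 ⟨⟨τ, fun x hx => if_neg hx⟩, rfl⟩, rfl⟩
  let q : Multiset (BuiltinAtom L) := r.headVars.val.map fun x => .eq (.var (f x)) (e x)
  have hq : ∀ {D : Type u} [L.Structure D] (v : ℕ → D),
      Sat v q ↔ ∀ x ∈ r.headVars, v (f x) = (e x).realize v := by
    intro D _ v
    simp [Sat, q, BuiltinAtom.Holds]
  have hhead : ∀ x ∈ r.headVars, ∀ y ∈ (e x).varFinset,
      y ∈ uvars ((r.kept.atoms + r.removed.atoms).map (UserAtom.subst e)) := fun x hx y hy =>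
    mem_uvars_map_subst.2 ⟨x, by rw [uvars_add]; exact Rule.mem_headVars.1 hx, hy⟩
  have hin : ∀ {d}, d ∈ r.kept.atoms ∨ d ∈ r.removed.atoms → ∀ x ∈ d.vars, x ∈ r.headVars :=
    fun hd x hx => Rule.mem_headVars.2 (hd.imp (fun h => ⟨_, h, hx⟩) fun h => ⟨_, h, hx⟩)
  have hloc : ∀ x ∈ (r.rename f).locals, x ∉ uvars k.1 ∧ x ∉ bvars (k.2 + q) ∧ x ∉ V := by
    intro y hy
    obtain ⟨x, hx, rfl⟩ := (Rule.mem_locals_rename hf).1 hy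
    refine ⟨fun h => hA _ (.inr (.inl h)) x rfl, ?_,
      fun h => hA _ (.inr (.inr (.inr h))) x rfl⟩
    rw [bvars_add]
    rintro (h | ⟨a, ha, h⟩)
    · exact hA _ (.inr (.inr (.inl h))) x rfl
    · obtain ⟨z, hz, rfl⟩ := Multiset.mem_map.1 ha
      have hz : z ∈ r.headVars := hz
      simp only [BuiltinAtom.vars, Term.varFinset, Finset.mem_union, Finset.mem_singleton] at h
      rcases h with h | h
      · exact (Rule.mem_locals.1 hx).2 (hf h ▸ hz)
      · exact hA _ (.inl (hhead z hz _ h)) x rfl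
  have h₁ : Refines CT (Goal.store (.and r.kept.toGoal (.and r.removed.toGoal r.guard.toGoal)) e
      + k).1 (Goal.store (.and r.kept.toGoal (.and r.removed.toGoal r.guard.toGoal)) e + k).2 V
      ((r.rename f).kept.atoms + ((r.rename f).removed.atoms + k.1))
      ((r.rename f).guard.atoms + (k.2 + q)) V := by
    simp only [Goal.store, Goal.users, Goal.builtins, Goal.users_toGoal, Goal.builtins_toGoal,
      Goal.users_builtin_toGoal, Goal.builtins_builtin_toGoal, Rule.rename, UserC.subst,
      BuiltinC.subst, Conj.atoms_map, Prod.fst_add, Prod.snd_add, add_zero, zero_add,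
      Multiset.map_add, add_assoc]
    refine ⟨fun a a' => (∃ d, (d ∈ r.kept.atoms ∨ d ∈ r.removed.atoms) ∧ a = d.subst e ∧
      a' = d.subst (renameVar f)) ∨ (a = a' ∧ a ∈ k.1), .inl ?_, ?_⟩
    · refine .add ?_ (.add ?_ (Multiset.rel_refl_of_refl_on fun a ha => .inr ⟨rfl, ha⟩))
      all_goals
        rw [Multiset.rel_map]
        exact Multiset.rel_refl_of_refl_on fun d hd => .inl ⟨d, by tauto, rfl, rfl⟩
    · intro p v ρ hv hρ
      -- Fresh variables, local ones included, take the values of the terms they stand for.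
      obtain ⟨w, hw, hw'⟩ := exists_transport hf Set.univ (fun x => (e x).realize v) v
      have hold : ∀ y, y ∈ uvars ((r.kept.atoms + r.removed.atoms).map (UserAtom.subst e)) ∨
          y ∈ uvars k.1 ∨ y ∈ bvars k.2 ∨ y ∈ V → w y = v y := fun y hy =>
        hw' y fun x _ => hA y hy x
      have hw : ∀ x, w (f x) = (e x).realize v := fun x => hw x trivial
      rw [sat_add, sat_subst] at hv
      refine ⟨w, ?_, fun x hx => (hold x (by tauto)).trans (hρ x hx).symm, ?_⟩
      · rw [sat_add, sat_add, sat_rename, funext hw, hq]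
        refine ⟨hv.1, (sat_congr fun x hx => hold x (by tauto)).2 hv.2, fun x hx => ?_⟩
        rw [hw]
        exact realize_congr fun y hy => (hold y (.inl (hhead x hx y hy))).symm
      · rintro a a' (⟨d, -, rfl, rfl⟩ | ⟨rfl, ha⟩)
        · exact .of_subst_subst _ _ fun x _ => (hw x).symm
        · exact .of_eqOn fun x hx => (hold x (.inr (.inl ⟨a, ha, hx⟩))).symm
  refine mem_pole_of_refines (m' := (_, _)) h₁ ?_
  -- The transition needs a consistent store; otherwise the target is entailed outright.
  by_cases hF : Failed CT ((r.rename f).guard.atoms + (k.2 + q))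
  · exact mem_pole_of_entails (cfg_failed_entails hF _)
  refine mem_pole_of_step (m' := (_, _)) (cfg_step hr₀ (hr.rename hf) hloc hCT hF) ?_
  refine mem_pole_of_refines ?_ hτ
  simp only [Goal.store, Goal.users, Goal.builtins, Goal.users_toGoal, Goal.builtins_toGoal,
    Goal.users_builtin_toGoal, Goal.builtins_builtin_toGoal, Rule.rename, UserC.subst,
    BuiltinC.subst, Conj.atoms_map, Prod.fst_add, Prod.snd_add, add_zero, zero_add,
    Multiset.map_add, Multiset.map_zero]
  have hτv : ∀ {D : Type u} [L.Structure D] (v : ℕ → D), Sat v q →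
      ∀ x ∈ r.headVars ∪ r.bodyVars, v (f x) = (τ x).realize v := by
    intro D _ v hv x hx
    by_cases h : x ∈ r.locals
    · simp [τ, h]
    · simp only [τ, if_neg h]
      refine (hq v).1 hv x ?_
      simp only [Rule.locals, Finset.mem_sdiff, Finset.mem_union] at h hx
      tauto
  refine ⟨fun a a' => (∃ d, (d ∈ r.kept.atoms ∨ d ∈ r.removed.atoms) ∧
    a = d.subst (renameVar f) ∧ a' = d.subst e) ∨ (∃ d ∈ r.bodyU.atoms,
      a = d.subst (renameVar f) ∧ a' = d.subst τ) ∨ a = a', .inl ?_, ?_⟩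
  · rw [add_comm k.1, add_assoc]
    refine .add ?_ (.add ?_ (Multiset.rel_refl_of_refl_on fun a ha => .inr (.inr rfl)))
    all_goals rw [Multiset.rel_map]
    · exact Multiset.rel_refl_of_refl_on fun d hd => .inl ⟨d, .inl hd, rfl, rfl⟩
    · exact Multiset.rel_refl_of_refl_on fun d hd => .inr (.inl ⟨d, hd, rfl, rfl⟩)
  · intro p v ρ hv hρ
    simp only [sat_add, sat_rename] at hv
    have hτv := hτv v hv.2.2.2
    refine ⟨v, ?_, fun x hx => (hρ x hx).symm, ?_⟩
    · simp only [sat_add, sat_subst]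
      refine ⟨hv.2.2.1, (sat_congr fun x hx => ?_).1 hv.2.1, (sat_congr fun x hx => ?_).1 hv.1⟩
      all_goals
        refine hτv x ?_
        simp [Rule.bodyVars, BuiltinC.mem_vars, hx]
    · rintro a a' (⟨d, hd, rfl, rfl⟩ | ⟨d, hd, rfl, rfl⟩ | rfl)
      · exact .of_subst_subst _ _ fun x hx => (hq v).1 hv.2.2.2 x (hin hd x hx)
      · refine .of_subst_subst _ _ fun x hx => hτv x ?_
        have : x ∈ uvars r.bodyU.atoms := ⟨d, hd, hx⟩
        simp [Rule.bodyVars, UserC.mem_vars, this]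
      · exact .of_eqOn fun _ _ => rfl

end Pole

end CHR

/-! ### Completeness -/

open CHR in
theorem mainTheorem1 {L : FirstOrder.Language.{u, u}} {C : ℕ → Type u}
    (P : CHR.Program L C) (CT : CHR.ConstraintTheory L) (hCT : CT.IsComplete)
    (S T : CHR.State L C)
    (h : CHR.Provable (CHR.sigmaP P ∪ CHR.sigmaCT C CT ∪ CHR.sigmaEq L C) {S.toL} T.toL) :
    ∃ T' : CHR.State L C,
      Relation.ReflTransGen (CHR.Step P CT) (S.cls CT) (T'.cls CT) ∧
        CHR.StateEntails CT (T'.cls CT) (T.cls CT) := by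
  obtain ⟨f, hf, hS⟩ := exists_cfg_eq_union CT (Goal.users S.store) (Goal.builtins S.store)
    S.glob T.glob
  set V := T.glob ∪ S.glob
  have hsound : Sound (pole P CT V (T.cls CT)) {S.toL} T.toL := by
    refine h.sound fun Γ α hα => ?_
    rcases hα with (hα | hα) | hα
    exacts [sound_sigmaP hCT hα, sound_sigmaCT hα, sound_sigmaEq hα]
  -- The local variables of `S` are instantiated by fresh variables, those of `T` by any terms.
  have hmem : ((Goal.users S.store).map (UserAtom.subst (renameVar f)),
      (Goal.builtins S.store).map (BuiltinAtom.subst (renameVar f))) ∈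
        interp (pole P CT V (T.cls CT)) S.toL (free .var) := by
    rw [State.toL, interp_exs]
    refine subset_cl (Set.mem_iUnion.2
      ⟨⟨fun x => if x ∈ S.store.vars \ S.glob then .var (f x) else .var x,
        fun x hx => if_neg hx⟩, ?_⟩)
    rw [interp_goal]
    apply subset_cl
    have key : ∀ x, x ∈ uvars (Goal.users S.store) ∨ x ∈ bvars (Goal.builtins S.store) →
        renameVar f x =
          if x ∈ S.store.vars \ S.glob then FirstOrder.Language.Term.var (L := L) (f x)
            else .var x := by
      intro x hx
      have hx := Goal.mem_vars.2 hx
      by_cases h : x ∈ S.glob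
      · simp [renameVar, h, hf x h]
      · simp [renameVar, h, hx]
    refine Prod.ext (Multiset.map_congr rfl fun a ha => UserAtom.subst_congr fun x hx =>
      key x (.inl ⟨a, ha, hx⟩)) (Multiset.map_congr rfl fun a ha => BuiltinAtom.subst_congr
        fun x hx => key x (.inr ⟨a, ha, hx⟩))
  have hsub : interp (pole P CT V (T.cls CT)) T.toL (free .var) ⊆ pole P CT V (T.cls CT) := by
    rw [State.toL, interp_exs]
    refine isFact_pole.cl_subset (Set.iUnion_subset fun ⟨e, he⟩ => ?_)
    rw [interp_goal]
    refine isFact_pole.cl_subset (Set.singleton_subset_iff.2 ?_)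
    refine mem_pole_of_entails ?_
    rw [cls_eq_cfg T]
    apply Refines.stateEntails
    have hg : ∀ x ∈ T.glob, e x = .var x := fun x hx => he x (by simp [hx])
    refine ⟨fun a a' => a = a'.subst e, .inl ?_, fun p v ρ hv hρ =>
      ⟨fun x => if x ∈ T.glob then ρ x else (e x).realize v, ?_, fun x hx => if_pos hx, ?_⟩⟩
    · simp only [Goal.store, Multiset.rel_map_left]
      exact Multiset.rel_refl_of_refl_on fun _ _ => rfl
    all_goals
      have key : (fun x => if x ∈ T.glob then ρ x else (e x).realize v) =
          fun x => (e x).realize v := by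
        funext x
        split_ifs with hx
        · rw [hg x hx, hρ x (Finset.mem_union_left _ hx)]; rfl
        · rfl
    · rw [key]
      exact sat_subst.1 hv
    · rw [key]
      rintro _ a rfl
      exact .of_subst _ fun _ _ => rfl
  have hreach := hsub (sound_singleton.1 hsound .var hmem)
  obtain ⟨Y, hY, hent⟩ := exists_steps_entails hCT hreach
  obtain ⟨T', rfl⟩ := Quotient.exists_rep Y
  exact ⟨T', by rw [cls_eq_cfg S, hS]; exact hY, hent⟩
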